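/- **Conventions.** A birestriction monoid is an algebra $(S;\cdot,{}^*,{}^+,1)$ such that $(S;\cdot,1)$ is a monoid and the identities $xx^*=x$, $x^*y^*=y^*x^*$, $(xy^*)^*=x^*y^*$, $x^*y=y(xy)^*$, their duals $x^+x=x$, $x^+y^+=y^+x^+$, $(x^+y)^+=x^+y^+$, $xy^+=(xy)^+x$, and $(x^+)^*=x^+$, $(x^*)^+=x^*$ hold. Its projections are the elements $s^*$ (equivalently $s^+$); $s\le t$ means $s=et$ for some projection $e$; $\sigma$ is the least congruence that identifies all projections. $S$ is $F$-birestriction if every $\sigma$-class has a maximum element; then $s^{\mathfrak m}$ denotes the maximum element of the $\sigma$-class of $s$, and $S$ is regarded as an algebra of signature $(\cdot,{}^*,{}^+,{}^{\mathfrak m},1)$ of type $(2,1,1,1,0)$. $S$ is left strong if $x^{\mathfrak m}y^{\mathfrak m}=(x^{\mathfrak m})^+(xy)^{\mathfrak m}$ for all $x,y$; right strong if $x^{\mathfrak m}y^{\mathfrak m}=(xy)^{\mathfrak m}(y^{\mathfrak m})^*$ for all $x,y$; strong if it is both left and right strong; and perfect if $x^{\mathfrak m}y^{\mathfrak m}=(xy)^{\mathfrak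 m}$ for all $x,y$. For $i=ls,rs,s,p$ let $\mathsf{FFBR}_i(X)$ be the free $X$-generated left strong, right strong, strong, respectively perfect, $F$-birestriction monoid. Let $X^*$ and $X^+$ be the free monoid and the free semigroup on $X$, let $\overline{X^+}=\{\overline u: u\in X^+\}$ be a copy of $X^+$ disjoint from $X$, and let $\mathcal F_i$ be the birestriction monoid generated by $X\cup\overline{X^+}$ subject to the relations $N_i$, where $$N_{ls}=\{\overline x\ge x,\ \overline u\,\overline v=\overline u^{+}\,\overline{uv}\},\qquad N_{rs}=\{\overline x\ge x,\ \overline u\,\overline v=\overline{uv}\,\overline v^{*}\},$$ $$N_s=N_{ls}\cup N_{rs},\qquad N_p=\{\overline x\ge x,\ \overline{uv}=\overline u\,\overline v\}$$ ($x\in X$, $u,v\in X^+$; $\overline x\ge x$ stands for $x=\overline x x^*$). Let $\mathcal I_i$ be the universal inverse monoid of $\mathcal F_i$, i.e. the inverse monoid generated by $X\cup\overline{X^+}$ subject to the relations $N_i$ read with $a^*=a^{-1}a$ and $a^+=aa^{-1}$. Let $E(\mathcal I_i)$ be its semilattice of idempotents, and put $\overline 1=1$ for the empty word. The monoid $X^*$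 acts partially on $E(\mathcal I_i)$ by the order isomorphisms $\varphi_u:\{e\le\overline u^{*}\}\to\{e\le\overline u^{+}\}$, $\varphi_u(e)=(\overline u e)^+$. The partial action product $E(\mathcal I_i)\rtimes X^*$ is the set of all pairs $(e,u)\in E(\mathcal I_i)\times X^*$ with $e\in\operatorname{ran}\varphi_u$, with $$(e,u)(f,v)=(\varphi_u(\varphi_u^{-1}(e)f),uv),\quad (e,u)^*=(\varphi_u^{-1}(e),1),\quad (e,u)^+=(e,1),$$ and with identity element $(1,1)$; it is a birestriction monoid. **Theorem.** Let $X$ be a non-empty set and $i\in\{ls,rs,s,p\}$. 1. $\mathcal F_i$ is an $F$-birestriction monoid, and there is a $(2,1,1,1,0)$-isomorphism $\mathsf{FFBR}_i(X)\to\mathcal F_i$ that maps $x$ to $x$ for every $x\in X$ and $u^{\mathfrak m}$ to $\overline u$ for every $u\in X^+$. 2. $E(\mathcal I_i)\rtimes X^*$ is an $F$-birestriction monoid, and the map $x\mapsto(x^+,x)$, $x\in X$, extends to a $(2,1,1,1,0)$-isomorphism $\mathsf{FFBR}_i(X)\to E(\mathcal I_i)\rtimes X^*$. In detail, $E(\mathcal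 I_i)\rtimes X^*=\{(e,u)\in E(\mathcal I_i)\times X^*: e\le\overline u^{+}\}$ has the identity element $(1,1)$ and the operations $$(e,u)(f,v)=(e(\overline u f)^+,uv),\quad (e,u)^*=((e\overline u)^*,1),\quad (e,u)^+=(e,1),\quad (e,u)^{\mathfrak m}=(\overline u^{+},u).$$ -/

import Mathlib

namespace FBirestr

/-! ## Birestriction monoids -/

/-- Birestriction monoids, as algebras `(S; ·, *, +, 1)`: `pstar x` is `x*`, `pplus x` is `x⁺`. -/
class BirestrictionMonoid (S : Type*) extends Monoid S where
  pstar : S → S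
  pplus : S → S
  mul_pstar : ∀ x : S, x * pstar x = x
  pstar_comm : ∀ x y : S, pstar x * pstar y = pstar y * pstar x
  pstar_mul_pstar : ∀ x y : S, pstar (x * pstar y) = pstar x * pstar y
  pstar_mul : ∀ x y : S, pstar x * y = y * pstar (x * y)
  pplus_mul : ∀ x : S, pplus x * x = x
  pplus_comm : ∀ x y : S, pplus x * pplus y = pplus y * pplus x
  pplus_pplus_mul : ∀ x y : S, pplus (pplus x * y) = pplus x * pplus y
  mul_pplus : ∀ x y : S, x * pplus y = pplus (x * y) * x
  pstar_pplus : ∀ x : S, pstar (pplus x) = pplus x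
  pplus_pstar : ∀ x : S, pplus (pstar x) = pstar x

open BirestrictionMonoid

section Birestriction

variable {S : Type*} [BirestrictionMonoid S]

/-- Projections: the elements of the form `s*` (equivalently, of the form `s⁺`). -/
def IsProj (e : S) : Prop := ∃ s : S, pstar s = e

/-- The natural partial order: `s ≤ t` iff `s = e t` for a projection `e`. -/
def NatLE (s t : S) : Prop := ∃ e : S, IsProj e ∧ s = e * t

variable (S) in
/-- The minimum congruence that identifies all the projections. -/
def sigma : Con S := conGen fun a b => IsProj a ∧ IsProj b

/-- `m` is the maximum element of the `σ`-class of `s`. -/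
def IsSigmaMax (s m : S) : Prop := sigma S s m ∧ ∀ t : S, sigma S s t → NatLE t m

theorem isProj_pplus (s : S) : IsProj (pplus s) := ⟨pplus s, pstar_pplus s⟩

theorem pstar_one : pstar (1 : S) = 1 := by simpa using mul_pstar (1 : S)

theorem isProj_one : IsProj (1 : S) := ⟨1, pstar_one⟩

theorem pstar_proj {e : S} (he : IsProj e) : pstar e = e := by
  obtain ⟨s, rfl⟩ := he
  simpa [pstar_one] using pstar_mul_pstar (1 : S) s

theorem pplus_proj {e : S} (he : IsProj e) : pplus e = e := by
  obtain ⟨s, rfl⟩ := he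
  exact pplus_pstar s

theorem proj_idem {e : S} (he : IsProj e) : e * e = e := by
  have h := mul_pstar e
  rwa [pstar_proj he] at h

theorem proj_comm {e f : S} (he : IsProj e) (hf : IsProj f) : e * f = f * e := by
  obtain ⟨s, rfl⟩ := he
  obtain ⟨t, rfl⟩ := hf
  exact pstar_comm s t

theorem proj_mul {e f : S} (he : IsProj e) (hf : IsProj f) : IsProj (e * f) := by
  obtain ⟨s, rfl⟩ := he
  obtain ⟨t, rfl⟩ := hf
  exact ⟨s * pstar t, pstar_mul_pstar s t⟩

/-- The description of `σ` through a common projection. -/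
theorem sigma_iff {a b : S} : sigma S a b ↔ ∃ e : S, IsProj e ∧ a * e = b * e := by
  constructor
  · intro h
    let c : Con S :=
      { r := fun a b => ∃ e : S, IsProj e ∧ a * e = b * e
        iseqv :=
          { refl := fun a => ⟨1, isProj_one, rfl⟩
            symm := fun ⟨e, he, h⟩ => ⟨e, he, h.symm⟩
            trans := by
              rintro x y z ⟨e, he, h⟩ ⟨f, hf, h'⟩
              refine ⟨e * f, proj_mul he hf, ?_⟩
              rw [← mul_assoc, h, mul_assoc, proj_comm he hf, ← mul_assoc, h', mul_assoc] }
        mul' := by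
          rintro w x y z ⟨e, he, h⟩ ⟨f, hf, h'⟩
          have hp : IsProj (pstar (e * y)) := ⟨_, rfl⟩
          have key : e * y = y * pstar (e * y) := by
            have := pstar_mul e y
            rwa [pstar_proj he] at this
          refine ⟨pstar (e * y) * f, proj_mul hp hf, ?_⟩
          calc w * y * (pstar (e * y) * f) = w * (y * pstar (e * y)) * f := by simp only [mul_assoc]
            _ = w * e * y * f := by rw [← key]; simp only [mul_assoc]
            _ = x * (e * y) * f := by rw [h]; simp only [mul_assoc]
            _ = x * (y * pstar (e * y)) * f := by rw [← key]
            _ = x * y * (pstar (e * y) * f) := by simp only [mul_assoc]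
            _ = x * (y * f) * pstar (e * y) := by
              rw [proj_comm hp hf]; simp only [mul_assoc]
            _ = x * z * (f * pstar (e * y)) := by rw [h']; simp only [mul_assoc]
            _ = x * z * (pstar (e * y) * f) := by rw [proj_comm hp hf] }
    have hle : sigma S ≤ c := by
      refine Con.conGen_le.2 ?_
      rintro x y ⟨hx, hy⟩
      exact ⟨x * y, proj_mul hx hy, by
        rw [← mul_assoc, proj_idem hx, proj_comm hx hy, ← mul_assoc, proj_idem hy]⟩
    exact hle h
  · rintro ⟨e, he, h⟩
    have h1 : sigma S e 1 := ConGen.Rel.of _ _ ⟨he, isProj_one⟩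
    have ha : sigma S (a * e) (a * 1) := (sigma S).mul ((sigma S).refl a) h1
    have hb : sigma S (b * e) (b * 1) := (sigma S).mul ((sigma S).refl b) h1
    rw [mul_one] at ha hb
    rw [h] at ha
    exact (sigma S).trans ((sigma S).symm ha) hb

theorem NatLE.antisymm {s t : S} (h : NatLE s t) (h' : NatLE t s) : s = t := by
  obtain ⟨e, he, rfl⟩ := h
  obtain ⟨f, hf, h'⟩ := h'
  calc e * t = e * (f * (e * t)) := by rw [← h']
    _ = f * ((e * e) * t) := by
      rw [← mul_assoc, proj_comm he hf]; simp only [mul_assoc]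
    _ = t := by rw [proj_idem he, ← h']

theorem NatLE.eq_mul_pstar {s t : S} (h : NatLE s t) : s = t * pstar s := by
  obtain ⟨e, he, rfl⟩ := h
  have := pstar_mul e t
  rwa [pstar_proj he] at this

theorem natLE_of_eq_mul_pstar {s t : S} (h : s = t * pstar s) : NatLE s t := by
  refine ⟨pplus (t * pstar s), isProj_pplus _, ?_⟩
  have := mul_pplus t (pstar s)
  rw [pplus_pstar] at this
  rw [← this, ← h]

theorem IsSigmaMax.unique {s m m' : S} (h : IsSigmaMax s m) (h' : IsSigmaMax s m') : m = m' :=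
  NatLE.antisymm (h'.2 m h.1) (h.2 m' h'.1)

theorem IsSigmaMax.congr {s t m : S} (hst : sigma S s t) (h : IsSigmaMax s m) : IsSigmaMax t m :=
  ⟨(sigma S).trans ((sigma S).symm hst) h.1, fun u hu => h.2 u ((sigma S).trans hst hu)⟩

end Birestriction

/-- Morphisms of birestriction monoids, i.e. `(2,1,1,0)`-morphisms. -/
structure IsBirestrictionHom {S T : Type*} [BirestrictionMonoid S] [BirestrictionMonoid T]
    (f : S → T) : Prop where
  map_one : f 1 = 1
  map_mul : ∀ x y, f (x * y) = f x * f y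
  map_pstar : ∀ x, f (pstar x) = pstar (f x)
  map_pplus : ∀ x, f (pplus x) = pplus (f x)

/-! ## `F`-birestriction monoids -/

/-- A birestriction monoid is `F`-birestriction if every `σ`-class has a maximum element. -/
class IsFBirestriction (S : Type*) [BirestrictionMonoid S] : Prop where
  exists_max : ∀ s : S, ∃ m : S, IsSigmaMax s m

section FBirestriction

variable {S : Type*} [BirestrictionMonoid S] [IsFBirestriction S]

/-- The maximum element of the `σ`-class of `s`. -/
noncomputable def mx (s : S) : S := (IsFBirestriction.exists_max s).choose

theorem mx_spec (s : S) : IsSigmaMax s (mx s) := (IsFBirestriction.exists_max s).choose_spec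

theorem mx_eq {s m : S} (h : IsSigmaMax s m) : mx s = m := (mx_spec s).unique h

theorem mx_congr {s t : S} (h : sigma S s t) : mx s = mx t := mx_eq ((mx_spec t).congr
  ((sigma S).symm h))

theorem mx_mul_pstar (s : S) : mx s * pstar s = s :=
  ((mx_spec s).2 s ((sigma S).refl s)).eq_mul_pstar.symm

theorem mx_mul_proj (s t : S) : mx (s * pstar t) = mx s :=
  mx_congr (sigma_iff.2 ⟨pstar t, ⟨t, rfl⟩, by rw [mul_assoc, proj_idem ⟨t, rfl⟩]⟩)

variable (S) in
/-- The map `τ : S/σ → S` that sends a `σ`-class to its maximum element. -/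
noncomputable def tau : (sigma S).Quotient → S :=
  fun q => Con.liftOn q mx fun _ _ h => mx_congr h

end FBirestriction

/-- Morphisms of `F`-birestriction monoids, i.e. `(2,1,1,1,0)`-morphisms. -/
structure IsFBirestrictionHom {S T : Type*} [BirestrictionMonoid S] [IsFBirestriction S]
    [BirestrictionMonoid T] [IsFBirestriction T] (f : S → T) : Prop
    extends IsBirestrictionHom f where
  map_mx : ∀ x, f (mx x) = mx (f x)

/-- Premorphisms from a monoid to a birestriction monoid. -/
structure IsPremorphism {M S : Type*} [Monoid M] [BirestrictionMonoid S] (φ : M → S) : Prop where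
  map_one : φ 1 = 1
  mul_le : ∀ m n, NatLE (φ m * φ n) (φ (m * n))

/-- The condition that makes a premorphism left strong. -/
def IsLeftStrong {M S : Type*} [Monoid M] [BirestrictionMonoid S] (φ : M → S) : Prop :=
  ∀ m n, φ m * φ n = pplus (φ m) * φ (m * n)

/-- The condition that makes a premorphism right strong. -/
def IsRightStrong {M S : Type*} [Monoid M] [BirestrictionMonoid S] (φ : M → S) : Prop :=
  ∀ m n, φ m * φ n = φ (m * n) * pstar (φ n)

/-- The four indices: left strong, right strong, strong, perfect. -/
inductive Strength
  | ls | rs | s | p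

/-- Left strong, right strong, strong and perfect `F`-birestriction monoids, in terms of the
premorphism `τ`. -/
def HasStrength (i : Strength) (S : Type*) [BirestrictionMonoid S] [IsFBirestriction S] : Prop :=
  match i with
  | .ls => IsPremorphism (tau S) ∧ IsLeftStrong (tau S)
  | .rs => IsPremorphism (tau S) ∧ IsRightStrong (tau S)
  | .s => IsPremorphism (tau S) ∧ IsLeftStrong (tau S) ∧ IsRightStrong (tau S)
  | .p => tau S 1 = 1 ∧ ∀ m n, tau S (m * n) = tau S m * tau S n

theorem tau_mk {S : Type*} [BirestrictionMonoid S] [IsFBirestriction S] (s : S) :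
    tau S (s : (sigma S).Quotient) = mx s := rfl

theorem isPremorphism_tau (S : Type*) [BirestrictionMonoid S] [IsFBirestriction S] :
    IsPremorphism (tau S) := by
  constructor
  · change mx (1 : S) = 1
    simpa [pstar_one] using mx_mul_pstar (1 : S)
  · intro m n
    induction m using Con.induction_on with | _ a =>
    induction n using Con.induction_on with | _ b =>
    change NatLE (mx a * mx b) (mx (a * b))
    exact (mx_spec (a * b)).2 _ ((sigma S).mul (mx_spec a).1 (mx_spec b).1)

/-! ## The free `F`-birestriction monoids of each kind -/

/-- Terms over `X` in the signature `(·, *, +, m, 1)`. -/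
inductive FTerm (X : Type*)
  | var (x : X)
  | one
  | mul (s t : FTerm X)
  | star (t : FTerm X)
  | plus (t : FTerm X)
  | mx (t : FTerm X)

/-- The smallest congruence on terms that contains all instances of the defining identities of the
variety of left strong, right strong, strong or perfect `F`-birestriction monoids. -/
inductive FRel {X : Type*} (i : Strength) : FTerm X → FTerm X → Prop
  | refl (a) : FRel i a a
  | symm {a b} : FRel i a b → FRel i b a
  | trans {a b c} : FRel i a b → FRel i b c → FRel i a c
  | mul_congr {a b c d} : FRel i a b → FRel i c d → FRel i (.mul a c) (.mul b d)
  | star_congr {a b} : FRel i a b → FRel i (.star a) (.star b)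
  | plus_congr {a b} : FRel i a b → FRel i (.plus a) (.plus b)
  | mx_congr {a b} : FRel i a b → FRel i (.mx a) (.mx b)
  | mul_assoc (x y z) : FRel i (.mul (.mul x y) z) (.mul x (.mul y z))
  | one_mul (x) : FRel i (.mul .one x) x
  | mul_one (x) : FRel i (.mul x .one) x
  | mul_star (x) : FRel i (.mul x (.star x)) x
  | star_comm (x y) : FRel i (.mul (.star x) (.star y)) (.mul (.star y) (.star x))
  | star_mul_star (x y) : FRel i (.star (.mul x (.star y))) (.mul (.star x) (.star y))
  | star_mul (x y) : FRel i (.mul (.star x) y) (.mul y (.star (.mul x y)))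
  | plus_mul (x) : FRel i (.mul (.plus x) x) x
  | plus_comm (x y) : FRel i (.mul (.plus x) (.plus y)) (.mul (.plus y) (.plus x))
  | plus_plus_mul (x y) : FRel i (.plus (.mul (.plus x) y)) (.mul (.plus x) (.plus y))
  | mul_plus (x y) : FRel i (.mul x (.plus y)) (.mul (.plus (.mul x y)) x)
  | star_plus (x) : FRel i (.star (.plus x)) (.plus x)
  | plus_star (x) : FRel i (.plus (.star x)) (.star x)
  | mx_mul_star (x) : FRel i (.mul (.mx x) (.star x)) x
  | mx_mul_proj (x y) : FRel i (.mx (.mul x (.star y))) (.mx x)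
  | left_strong (hi : i = .ls ∨ i = .s) (x y) :
      FRel i (.mul (.mx x) (.mx y)) (.mul (.plus (.mx x)) (.mx (.mul x y)))
  | right_strong (hi : i = .rs ∨ i = .s) (x y) :
      FRel i (.mul (.mx x) (.mx y)) (.mul (.mx (.mul x y)) (.star (.mx y)))
  | perfect (hi : i = .p) (x y) :
      FRel i (.mul (.mx x) (.mx y)) (.mx (.mul x y))

/-- The setoid of provable equality of terms. -/
def FTerm.setoid (X : Type*) (i : Strength) : Setoid (FTerm X) :=
  ⟨FRel i, .refl, .symm, .trans⟩

/-- The free `X`-generated (left strong, right strong, strong, perfect) `F`-birestriction monoid: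
the relatively free algebra of the variety, i.e. terms modulo the equational theory. -/
def FFBR (i : Strength) (X : Type*) : Type _ := Quotient (FTerm.setoid X i)

namespace FFBR

variable {i : Strength} {X : Type*}

/-- The class of a term. -/
def mk (t : FTerm X) : FFBR i X := Quotient.mk (FTerm.setoid X i) t

/-- The assignment map `X → FFBR_i(X)`. -/
def of (x : X) : FFBR i X := mk (.var x)

theorem sound {a b : FTerm X} (h : FRel i a b) : (mk a : FFBR i X) = mk b :=
  Quotient.sound (s := FTerm.setoid X i) h

theorem ind {p : FFBR i X → Prop} (h : ∀ t, p (mk t)) (q : FFBR i X) : p q :=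
  Quotient.ind (s := FTerm.setoid X i) h q

instance : BirestrictionMonoid (FFBR i X) where
  one := mk .one
  mul := Quotient.map₂ (sa := FTerm.setoid X i) (sb := FTerm.setoid X i) (sc := FTerm.setoid X i)
    .mul fun _ _ h _ _ h' => FRel.mul_congr h h'
  pstar := Quotient.map (sa := FTerm.setoid X i) (sb := FTerm.setoid X i)
    .star fun _ _ h => FRel.star_congr h
  pplus := Quotient.map (sa := FTerm.setoid X i) (sb := FTerm.setoid X i)
    .plus fun _ _ h => FRel.plus_congr h
  mul_assoc := ind fun x => ind fun y => ind fun z => sound (.mul_assoc x y z)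
  one_mul := ind fun x => sound (.one_mul x)
  mul_one := ind fun x => sound (.mul_one x)
  mul_pstar := ind fun x => sound (.mul_star x)
  pstar_comm := ind fun x => ind fun y => sound (.star_comm x y)
  pstar_mul_pstar := ind fun x => ind fun y => sound (.star_mul_star x y)
  pstar_mul := ind fun x => ind fun y => sound (.star_mul x y)
  pplus_mul := ind fun x => sound (.plus_mul x)
  pplus_comm := ind fun x => ind fun y => sound (.plus_comm x y)
  pplus_pplus_mul := ind fun x => ind fun y => sound (.plus_plus_mul x y)
  mul_pplus := ind fun x => ind fun y => sound (.mul_plus x y)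
  pstar_pplus := ind fun x => sound (.star_plus x)
  pplus_pstar := ind fun x => sound (.plus_star x)

/-- The operation `m` of the term algebra gives the maximum of the `σ`-class. -/
theorem isSigmaMax_mk (t : FTerm X) : IsSigmaMax (mk t : FFBR i X) (mk (.mx t)) := by
  have h1 : ∀ t : FTerm X, (mk (.mx t) : FFBR i X) * pstar (mk t) = mk t :=
    fun t => sound (.mx_mul_star t)
  refine ⟨sigma_iff.2 ⟨pstar (mk t), ⟨_, rfl⟩, ?_⟩, ?_⟩
  · rw [h1, mul_pstar]
  · refine ind fun t' h => ?_
    obtain ⟨e, he, h⟩ := sigma_iff.1 h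
    obtain ⟨q, rfl⟩ := he
    induction q using ind with | _ r =>
    let F : FFBR i X → FFBR i X := Quotient.map (sa := FTerm.setoid X i) (sb := FTerm.setoid X i)
      .mx fun _ _ h => FRel.mx_congr h
    have hF : ∀ a : FTerm X, F (mk a * pstar (mk r)) = mk (.mx a) :=
      fun a => sound (.mx_mul_proj a r)
    have e1 : (mk (.mx t) : FFBR i X) = mk (.mx t') := by rw [← hF t, h, hF t']
    rw [e1]
    exact natLE_of_eq_mul_pstar (h1 t').symm

instance : IsFBirestriction (FFBR i X) where
  exists_max := ind fun t => ⟨_, isSigmaMax_mk t⟩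

theorem mx_mk (t : FTerm X) : mx (mk t : FFBR i X) = mk (.mx t) := mx_eq (isSigmaMax_mk t)

theorem hasStrength : HasStrength i (FFBR i X) := by
  have L : i = .ls ∨ i = .s → IsLeftStrong (tau (FFBR i X)) := by
    intro hi m n
    induction m using Con.induction_on with | _ a =>
    induction n using Con.induction_on with | _ b =>
    induction a using ind with | _ a =>
    induction b using ind with | _ b =>
    change mx (mk a) * mx (mk b) = pplus (mx (mk a)) * mx (mk (.mul a b))
    rw [mx_mk, mx_mk, mx_mk]
    exact sound (.left_strong hi a b)
  have R : i = .rs ∨ i = .s → IsRightStrong (tau (FFBR i X)) := by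
    intro hi m n
    induction m using Con.induction_on with | _ a =>
    induction n using Con.induction_on with | _ b =>
    induction a using ind with | _ a =>
    induction b using ind with | _ b =>
    change mx (mk a) * mx (mk b) = mx (mk (.mul a b)) * pstar (mx (mk b))
    rw [mx_mk, mx_mk, mx_mk]
    exact sound (.right_strong hi a b)
  have hp := isPremorphism_tau (FFBR i X)
  cases i with
  | ls => exact ⟨hp, L (Or.inl rfl)⟩
  | rs => exact ⟨hp, R (Or.inl rfl)⟩
  | s => exact ⟨hp, L (Or.inr rfl), R (Or.inr rfl)⟩
  | p =>
    refine ⟨hp.map_one, fun m n => ?_⟩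
    induction m using Con.induction_on with | _ a =>
    induction n using Con.induction_on with | _ b =>
    induction a using ind with | _ a =>
    induction b using ind with | _ b =>
    change mx (mk (.mul a b)) = mx (mk a) * mx (mk b)
    rw [mx_mk, mx_mk, mx_mk]
    exact (sound (.perfect rfl a b)).symm

/-- The value of a term under an assignment. -/
noncomputable def eval {T : Type*} [BirestrictionMonoid T] [IsFBirestriction T] (f : X → T) :
    FTerm X → T
  | .var x => f x
  | .one => 1
  | .mul s t => eval f s * eval f t
  | .star t => pstar (eval f t)
  | .plus t => pplus (eval f t)
  | .mx t => mx (eval f t)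

/-- The universal property of the free object. -/
theorem existsUnique_lift {T : Type*} [BirestrictionMonoid T] [IsFBirestriction T]
    (hT : HasStrength i T) (f : X → T) :
    ∃! h : FFBR i X → T, IsFBirestrictionHom h ∧ ∀ x, h (of x) = f x := by
  have L : i = .ls ∨ i = .s → ∀ a b : T, mx a * mx b = pplus (mx a) * mx (a * b) := by
    rintro (rfl | rfl) a b
    · exact hT.2 (a : (sigma T).Quotient) b
    · exact hT.2.1 (a : (sigma T).Quotient) b
  have R : i = .rs ∨ i = .s → ∀ a b : T, mx a * mx b = mx (a * b) * pstar (mx b) := by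
    rintro (rfl | rfl) a b
    · exact hT.2 (a : (sigma T).Quotient) b
    · exact hT.2.2 (a : (sigma T).Quotient) b
  have P : i = .p → ∀ a b : T, mx a * mx b = mx (a * b) := by
    rintro rfl a b
    exact (hT.2 (a : (sigma T).Quotient) b).symm
  have key : ∀ a b : FTerm X, FRel i a b → eval f a = eval f b := by
    intro a b h
    induction h with
    | refl a => rfl
    | symm _ ih => exact ih.symm
    | trans _ _ ih ih' => exact ih.trans ih'
    | mul_congr _ _ ih ih' => exact congrArg₂ (· * ·) ih ih'
    | star_congr _ ih => exact congrArg pstar ih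
    | plus_congr _ ih => exact congrArg pplus ih
    | mx_congr _ ih => exact congrArg mx ih
    | mul_assoc x y z => exact _root_.mul_assoc _ _ _
    | one_mul x => exact _root_.one_mul _
    | mul_one x => exact _root_.mul_one _
    | mul_star x => exact mul_pstar _
    | star_comm x y => exact pstar_comm _ _
    | star_mul_star x y => exact pstar_mul_pstar _ _
    | star_mul x y => exact pstar_mul _ _
    | plus_mul x => exact pplus_mul _
    | plus_comm x y => exact pplus_comm _ _
    | plus_plus_mul x y => exact pplus_pplus_mul _ _
    | mul_plus x y => exact mul_pplus _ _
    | star_plus x => exact pstar_pplus _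
    | plus_star x => exact pplus_pstar _
    | mx_mul_star x => exact mx_mul_pstar _
    | mx_mul_proj x y => exact FBirestr.mx_mul_proj _ _
    | left_strong hi x y => exact L hi _ _
    | right_strong hi x y => exact R hi _ _
    | perfect hi x y => exact P hi _ _
  refine ⟨Quotient.lift (s := FTerm.setoid X i) (eval f) key, ⟨⟨⟨rfl, ?_, ?_, ?_⟩, ?_⟩, ?_⟩, ?_⟩
  · exact ind fun a => ind fun b => rfl
  · exact ind fun a => rfl
  · exact ind fun a => rfl
  · refine ind fun a => ?_
    rw [mx_mk]
    rfl
  · exact fun x => rfl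
  · rintro g ⟨hg, hgx⟩
    funext q
    induction q using ind with | _ t =>
    change g (mk t) = eval f t
    induction t with
    | var x => exact hgx x
    | one => exact hg.map_one
    | mul s t ih ih' =>
      rw [eval, ← ih, ← ih']
      exact hg.map_mul (mk s) (mk t)
    | star t ih =>
      rw [eval, ← ih]
      exact hg.map_pstar (mk t)
    | plus t ih =>
      rw [eval, ← ih]
      exact hg.map_pplus (mk t)
    | mx t ih => rw [eval, ← ih, ← mx_mk, hg.map_mx]

end FFBR

/-! ## Presentations of birestriction monoids -/

/-- Terms over `Y` in the signature `(·, *, +, 1)`. -/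
inductive BTerm (Y : Type*)
  | var (y : Y)
  | one
  | mul (s t : BTerm Y)
  | star (t : BTerm Y)
  | plus (t : BTerm Y)

/-- The smallest congruence on terms that contains all instances of the defining identities of
birestriction monoids and the relations `R`. -/
inductive BRel {Y : Type*} (R : BTerm Y → BTerm Y → Prop) : BTerm Y → BTerm Y → Prop
  | rel {a b} : R a b → BRel R a b
  | refl (a) : BRel R a a
  | symm {a b} : BRel R a b → BRel R b a
  | trans {a b c} : BRel R a b → BRel R b c → BRel R a c
  | mul_congr {a b c d} : BRel R a b → BRel R c d → BRel R (.mul a c) (.mul b d)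
  | star_congr {a b} : BRel R a b → BRel R (.star a) (.star b)
  | plus_congr {a b} : BRel R a b → BRel R (.plus a) (.plus b)
  | mul_assoc (x y z) : BRel R (.mul (.mul x y) z) (.mul x (.mul y z))
  | one_mul (x) : BRel R (.mul .one x) x
  | mul_one (x) : BRel R (.mul x .one) x
  | mul_star (x) : BRel R (.mul x (.star x)) x
  | star_comm (x y) : BRel R (.mul (.star x) (.star y)) (.mul (.star y) (.star x))
  | star_mul_star (x y) : BRel R (.star (.mul x (.star y))) (.mul (.star x) (.star y))
  | star_mul (x y) : BRel R (.mul (.star x) y) (.mul y (.star (.mul x y)))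
  | plus_mul (x) : BRel R (.mul (.plus x) x) x
  | plus_comm (x y) : BRel R (.mul (.plus x) (.plus y)) (.mul (.plus y) (.plus x))
  | plus_plus_mul (x y) : BRel R (.plus (.mul (.plus x) y)) (.mul (.plus x) (.plus y))
  | mul_plus (x y) : BRel R (.mul x (.plus y)) (.mul (.plus (.mul x y)) x)
  | star_plus (x) : BRel R (.star (.plus x)) (.plus x)
  | plus_star (x) : BRel R (.plus (.star x)) (.star x)

/-- The setoid of equality of terms that follows from the relations `R`. -/
def BTerm.setoid {Y : Type*} (R : BTerm Y → BTerm Y → Prop) : Setoid (BTerm Y) :=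
  ⟨BRel R, .refl, .symm, .trans⟩

/-- `BRestr⟨Y | R⟩`, the birestriction monoid generated by `Y` subject to the relations `R`. -/
def BRestr (Y : Type*) (R : BTerm Y → BTerm Y → Prop) : Type _ := Quotient (BTerm.setoid R)

namespace BRestr

variable {Y : Type*} {R : BTerm Y → BTerm Y → Prop}

/-- The class of a term. -/
def mk (t : BTerm Y) : BRestr Y R := Quotient.mk (BTerm.setoid R) t

/-- The assignment map `Y → BRestr⟨Y | R⟩`. -/
def of (y : Y) : BRestr Y R := mk (.var y)

theorem sound {a b : BTerm Y} (h : BRel R a b) : (mk a : BRestr Y R) = mk b :=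
  Quotient.sound (s := BTerm.setoid R) h

theorem ind {p : BRestr Y R → Prop} (h : ∀ t, p (mk t)) (q : BRestr Y R) : p q :=
  Quotient.ind (s := BTerm.setoid R) h q

instance : BirestrictionMonoid (BRestr Y R) where
  one := mk .one
  mul := Quotient.map₂ (sa := BTerm.setoid R) (sb := BTerm.setoid R) (sc := BTerm.setoid R)
    .mul fun _ _ h _ _ h' => BRel.mul_congr h h'
  pstar := Quotient.map (sa := BTerm.setoid R) (sb := BTerm.setoid R)
    .star fun _ _ h => BRel.star_congr h
  pplus := Quotient.map (sa := BTerm.setoid R) (sb := BTerm.setoid R)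
    .plus fun _ _ h => BRel.plus_congr h
  mul_assoc := ind fun x => ind fun y => ind fun z => sound (.mul_assoc x y z)
  one_mul := ind fun x => sound (.one_mul x)
  mul_one := ind fun x => sound (.mul_one x)
  mul_pstar := ind fun x => sound (.mul_star x)
  pstar_comm := ind fun x => ind fun y => sound (.star_comm x y)
  pstar_mul_pstar := ind fun x => ind fun y => sound (.star_mul_star x y)
  pstar_mul := ind fun x => ind fun y => sound (.star_mul x y)
  pplus_mul := ind fun x => sound (.plus_mul x)
  pplus_comm := ind fun x => ind fun y => sound (.plus_comm x y)
  pplus_pplus_mul := ind fun x => ind fun y => sound (.plus_plus_mul x y)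
  mul_pplus := ind fun x => ind fun y => sound (.mul_plus x y)
  pstar_pplus := ind fun x => sound (.star_plus x)
  pplus_pstar := ind fun x => sound (.plus_star x)

end BRestr

/-! ## Inverse monoids and their presentations -/

/-- Inverse monoids, through their standard identities in the signature `(·, ⁻¹, 1)`. -/
class InverseMonoid (I : Type*) extends Monoid I, InvolutiveInv I where
  mul_inv_rev' : ∀ a b : I, (a * b)⁻¹ = b⁻¹ * a⁻¹
  mul_inv_mul : ∀ a : I, a * a⁻¹ * a = a
  inv_comm : ∀ a b : I, a * a⁻¹ * (b * b⁻¹) = b * b⁻¹ * (a * a⁻¹)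

section InverseMonoid

variable {I : Type*} [InverseMonoid I]

open InverseMonoid

theorem inv_mul_inv (a : I) : a⁻¹ * a * a⁻¹ = a⁻¹ := by
  simpa using mul_inv_mul a⁻¹

theorem inv_eq_of_idem {e : I} (he : e * e = e) : e⁻¹ = e := by
  have hi : e⁻¹ * e⁻¹ = e⁻¹ := by rw [← mul_inv_rev', he]
  have hc : e * e⁻¹ * (e⁻¹ * e) = e⁻¹ * e * (e * e⁻¹) := by
    simpa using inv_comm e e⁻¹
  have h1 : e * e⁻¹ * (e⁻¹ * e) = e := by
    rw [mul_assoc, ← mul_assoc e⁻¹, hi, ← mul_assoc, mul_inv_mul]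
  have h2 : e⁻¹ * e * (e * e⁻¹) = e⁻¹ := by
    rw [mul_assoc, ← mul_assoc e, he, ← mul_assoc, inv_mul_inv]
  rw [← h2, ← hc, h1]

theorem idem_comm {e f : I} (he : e * e = e) (hf : f * f = f) : e * f = f * e := by
  have h := inv_comm e f
  rwa [inv_eq_of_idem he, inv_eq_of_idem hf, he, hf] at h

variable (I) in
/-- `E(I)`, the semilattice of idempotents. -/
structure Idem where
  val : I
  idem : val * val = val

namespace Idem

@[ext] theorem ext {e f : Idem I} (h : e.1 = f.1) : e = f := by
  cases e; cases f; cases h; rfl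

/-- The natural partial order on idempotents: `e ≤ f` iff `e f = e`; the meet is the product. -/
instance : SemilatticeInf (Idem I) where
  le e f := e.1 * f.1 = e.1
  le_refl e := e.2
  le_trans e f g (h : e.1 * f.1 = e.1) (h' : f.1 * g.1 = f.1) := by
    rw [← h, mul_assoc, h']
  le_antisymm e f (h : e.1 * f.1 = e.1) (h' : f.1 * e.1 = f.1) := by
    apply ext
    rw [← h, idem_comm e.2 f.2, h']
  inf e f := ⟨e.1 * f.1, by
    rw [mul_assoc, ← mul_assoc f.1, idem_comm f.2 e.2, mul_assoc, f.2, ← mul_assoc, e.2]⟩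
  inf_le_left e f := by
    change e.1 * f.1 * e.1 = e.1 * f.1
    rw [mul_assoc, idem_comm f.2 e.2, ← mul_assoc, e.2]
  inf_le_right e f := by
    change e.1 * f.1 * f.1 = e.1 * f.1
    rw [mul_assoc, f.2]
  le_inf e f g (h : e.1 * f.1 = e.1) (h' : e.1 * g.1 = e.1) := by
    change e.1 * (f.1 * g.1) = e.1
    rw [← mul_assoc, h, h']

instance : OrderTop (Idem I) where
  top := ⟨1, one_mul 1⟩
  le_top e := mul_one e.1

theorem le_def {e f : Idem I} : e ≤ f ↔ e.1 * f.1 = e.1 := Iff.rfl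

theorem le_iff' {e f : Idem I} : e ≤ f ↔ f.1 * e.1 = e.1 := by
  rw [le_def, idem_comm e.2 f.2]

/-- `a⁺ = a a⁻¹`. -/
def plus (a : I) : Idem I := ⟨a * a⁻¹, by rw [← mul_assoc, mul_inv_mul]⟩

/-- `a* = a⁻¹ a`. -/
def star (a : I) : Idem I := ⟨a⁻¹ * a, by rw [← mul_assoc, inv_mul_inv]⟩

/-- The idempotent `a e a⁻¹ = (a e)⁺`. -/
def conj (a : I) (e : Idem I) : Idem I := ⟨a * e.1 * a⁻¹, by
  have h : e.1 * (a⁻¹ * a) = a⁻¹ * a * e.1 := idem_comm e.2 (star a).2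
  calc a * e.1 * a⁻¹ * (a * e.1 * a⁻¹) = a * (e.1 * (a⁻¹ * a)) * e.1 * a⁻¹ := by
        simp only [mul_assoc]
    _ = a * a⁻¹ * a * (e.1 * e.1) * a⁻¹ := by rw [h]; simp only [mul_assoc]
    _ = a * e.1 * a⁻¹ := by rw [mul_inv_mul, e.2]⟩

theorem conj_mono (a : I) {e f : Idem I} (h : e ≤ f) : conj a e ≤ conj a f := by
  have hc : e.1 * (a⁻¹ * a) = a⁻¹ * a * e.1 := idem_comm e.2 (star a).2
  change a * e.1 * a⁻¹ * (a * f.1 * a⁻¹) = a * e.1 * a⁻¹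
  calc a * e.1 * a⁻¹ * (a * f.1 * a⁻¹) = a * (e.1 * (a⁻¹ * a)) * f.1 * a⁻¹ := by
        simp only [mul_assoc]
    _ = a * a⁻¹ * a * (e.1 * f.1) * a⁻¹ := by rw [hc]; simp only [mul_assoc]
    _ = a * e.1 * a⁻¹ := by rw [mul_inv_mul, le_def.1 h]

theorem conj_le_plus (a : I) (e : Idem I) : conj a e ≤ plus a := by
  change a * e.1 * a⁻¹ * (a * a⁻¹) = a * e.1 * a⁻¹
  rw [mul_assoc, ← mul_assoc a⁻¹, inv_mul_inv]

theorem conj_inv_conj {a : I} {e : Idem I} (h : e ≤ star a) : conj a⁻¹ (conj a e) = e := by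
  apply ext
  change a⁻¹ * (a * e.1 * a⁻¹) * a⁻¹⁻¹ = e.1
  have h1 : e.1 * (a⁻¹ * a) = e.1 := h
  have h2 : a⁻¹ * a * e.1 = e.1 := le_iff'.1 h
  calc a⁻¹ * (a * e.1 * a⁻¹) * a⁻¹⁻¹ = a⁻¹ * a * e.1 * (a⁻¹ * a) := by
        rw [inv_inv]; simp only [mul_assoc]
    _ = e.1 := by rw [h2, h1]

theorem star_inv (a : I) : star a⁻¹ = plus a := ext (by change a⁻¹⁻¹ * a⁻¹ = _; rw [inv_inv]; rfl)

theorem plus_inv (a : I) : plus a⁻¹ = star a := ext (by change a⁻¹ * a⁻¹⁻¹ = _; rw [inv_inv]; rfl)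

end Idem

end InverseMonoid

/-- Words over `Y ∪ Y⁻¹`, i.e. the free involutive monoid over `Y`:
`(y, true)` is the letter `y` and `(y, false)` is the letter `y⁻¹`. -/
abbrev InvWord (Y : Type*) : Type _ := FreeMonoid (Y × Bool)

/-- The involution on words, `(y₁ ⋯ yₙ)⁻¹ = yₙ⁻¹ ⋯ y₁⁻¹`. -/
def InvWord.inv {Y : Type*} (w : InvWord Y) : InvWord Y :=
  FreeMonoid.ofList (FreeGroup.invRev w.toList)

theorem InvWord.inv_inv {Y : Type*} (w : InvWord Y) : w.inv.inv = w :=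
  FreeGroup.invRev_invRev (L₁ := w.toList)

theorem InvWord.inv_mul {Y : Type*} (v w : InvWord Y) : (v * w).inv = w.inv * v.inv :=
  FreeGroup.invRev_append (L₁ := v.toList) (L₂ := w.toList)

/-- The defining relations of the free inverse monoid, together with the relations `R` and their
inverses (so that the generated monoid congruence respects the inversion). -/
inductive InvRel {Y : Type*} (R : InvWord Y → InvWord Y → Prop) : InvWord Y → InvWord Y → Prop
  | regular (u) : InvRel R (u * u.inv * u) u
  | comm (u v) : InvRel R (u * u.inv * (v * v.inv)) (v * v.inv * (u * u.inv))
  | rel {u v} : R u v → InvRel R u v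
  | rel_inv {u v} : R u v → InvRel R u.inv v.inv

/-- `Inv⟨Y | R⟩`, the inverse monoid generated by `Y` subject to the relations `R`. -/
def InvPres (Y : Type*) (R : InvWord Y → InvWord Y → Prop) : Type _ := (conGen (InvRel R)).Quotient

namespace InvPres

variable {Y : Type*} {R : InvWord Y → InvWord Y → Prop}

/-- The value of a word. -/
def mk (w : InvWord Y) : InvPres Y R := Con.toQuotient w

/-- The assignment map `Y → Inv⟨Y | R⟩`. -/
def of (y : Y) : InvPres Y R := mk (FreeMonoid.of (y, true))

theorem sound {u v : InvWord Y} (h : conGen (InvRel R) u v) : (mk u : InvPres Y R) = mk v :=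
  (Con.eq _).2 h

theorem ind {p : InvPres Y R → Prop} (h : ∀ w, p (mk w)) (q : InvPres Y R) : p q :=
  Con.induction_on q h

theorem conGen_inv {u v : InvWord Y} (h : conGen (InvRel R) u v) :
    conGen (InvRel R) u.inv v.inv := by
  let c : Con (InvWord Y) :=
    { r := fun u v => conGen (InvRel R) u.inv v.inv
      iseqv := ⟨fun _ => Con.refl _ _, fun h => Con.symm _ h, fun h h' => Con.trans _ h h'⟩
      mul' := fun h h' => by
        rw [InvWord.inv_mul, InvWord.inv_mul]
        exact Con.mul _ h' h }
  have hle : conGen (InvRel R) ≤ c := by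
    refine Con.conGen_le.2 ?_
    intro u v h
    refine ConGen.Rel.of _ _ ?_
    cases h with
    | regular =>
      have := InvRel.regular (R := R) v.inv
      simpa only [InvWord.inv_mul, InvWord.inv_inv, mul_assoc] using this
    | comm a b =>
      have := InvRel.comm (R := R) b a
      simpa only [InvWord.inv_mul, InvWord.inv_inv, mul_assoc] using this
    | rel h => exact .rel_inv h
    | rel_inv h =>
      rw [InvWord.inv_inv, InvWord.inv_inv]
      exact .rel h
  exact hle h

instance : InverseMonoid (InvPres Y R) where
  toMonoid := inferInstanceAs (Monoid (conGen (InvRel R)).Quotient)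
  inv q := Con.liftOn q (fun w => mk w.inv) fun _ _ h => sound (conGen_inv h)
  inv_inv := ind fun w => congrArg mk w.inv_inv
  mul_inv_rev' := ind fun v => ind fun w => congrArg mk (InvWord.inv_mul v w)
  mul_inv_mul := ind fun w => sound (ConGen.Rel.of _ _ (.regular w))
  inv_comm := ind fun v => ind fun w => sound (ConGen.Rel.of _ _ (.comm v w))

end InvPres

/-- The word that represents the image of a birestriction term under the canonical morphism `ψ`
to the free inverse monoid (where `a* = a⁻¹ a` and `a⁺ = a a⁻¹`). -/
def BTerm.psi {Y : Type*} : BTerm Y → InvWord Y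
  | .var y => FreeMonoid.of (y, true)
  | .one => 1
  | .mul s t => s.psi * t.psi
  | .star t => t.psi.inv * t.psi
  | .plus t => t.psi * t.psi.inv

/-- The universal inverse monoid `Inv⟨Y | ψ(R)⟩` of `BRestr⟨Y | R⟩`. -/
abbrev UnivInv (Y : Type*) (R : BTerm Y → BTerm Y → Prop) : Type _ :=
  InvPres Y (Relation.Map R BTerm.psi BTerm.psi)

/-! ## Partial actions on semilattices and partial action products -/

/-- A partial action of a monoid `M` on a semilattice `E` by order isomorphisms between order
ideals, i.e. a premorphism from `M` to the inverse monoid of such isomorphisms. The values of the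
underlying functions outside of the sources and targets carry no information. -/
structure PartialAction (M E : Type*) [Monoid M] [SemilatticeInf E] where
  act : M → PartialEquiv E E
  source_nonempty : ∀ m, (act m).source.Nonempty
  source_lower : ∀ m, IsLowerSet (act m).source
  target_lower : ∀ m, IsLowerSet (act m).target
  le_iff : ∀ m, ∀ e ∈ (act m).source, ∀ f ∈ (act m).source, act m e ≤ act m f ↔ e ≤ f
  source_one : (act 1).source = Set.univ
  one_act : ∀ e, act 1 e = e
  mul_mem : ∀ m n, ∀ e ∈ (act n).source, act n e ∈ (act m).source → e ∈ (act (m * n)).source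
  mul_act : ∀ m n, ∀ e ∈ (act n).source, act n e ∈ (act m).source →
    act (m * n) e = act m (act n e)

namespace PartialAction

variable {M E : Type*} [Monoid M] [SemilatticeInf E] (φ : PartialAction M E)

theorem map_inf {m : M} {e f : E} (he : e ∈ (φ.act m).source) (hf : f ∈ (φ.act m).source) :
    φ.act m (e ⊓ f) = φ.act m e ⊓ φ.act m f := by
  have hef := φ.source_lower m inf_le_left he (a := e) (b := e ⊓ f)
  apply le_antisymm
  · exact le_inf ((φ.le_iff m _ hef _ he).2 inf_le_left) ((φ.le_iff m _ hef _ hf).2 inf_le_right)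
  · have ht : φ.act m e ⊓ φ.act m f ∈ (φ.act m).target :=
      φ.target_lower m inf_le_left ((φ.act m).map_source he)
    have hs := (φ.act m).map_target ht
    have hr := (φ.act m).right_inv ht
    rw [← hr, φ.le_iff m _ hs _ hef]
    refine le_inf ?_ ?_
    · rw [← φ.le_iff m _ hs _ he, hr]
      exact inf_le_left
    · rw [← φ.le_iff m _ hs _ hf, hr]
      exact inf_le_right

theorem symm_le_iff {m : M} {e f : E} (he : e ∈ (φ.act m).target) (hf : f ∈ (φ.act m).target) :
    (φ.act m).symm e ≤ (φ.act m).symm f ↔ e ≤ f := by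
  rw [← φ.le_iff m _ ((φ.act m).map_target he) _ ((φ.act m).map_target hf),
    (φ.act m).right_inv he, (φ.act m).right_inv hf]

theorem one_mem_source (e : E) : e ∈ (φ.act 1).source := by
  rw [φ.source_one]
  trivial

theorem one_mem_target (e : E) : e ∈ (φ.act 1).target := by
  have := (φ.act 1).map_source (φ.one_mem_source e)
  rwa [φ.one_act] at this

theorem one_symm (e : E) : (φ.act 1).symm e = e := by
  have := (φ.act 1).left_inv (φ.one_mem_source e)
  rwa [φ.one_act] at this

/-- The partial action product `E ⋊ M = {(e, m) : e ∈ ran φ_m}`. -/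
structure Prod where
  val : E × M
  mem : val.1 ∈ (φ.act val.2).target

variable {φ}

namespace Prod

theorem ext {a b : φ.Prod} (h1 : a.1.1 = b.1.1) (h2 : a.1.2 = b.1.2) : a = b := by
  obtain ⟨⟨a1, a2⟩, ha⟩ := a
  obtain ⟨⟨b1, b2⟩, hb⟩ := b
  cases h1
  cases h2
  rfl

theorem symm_inf_mem (a : φ.Prod) (f : E) :
    (φ.act a.1.2).symm a.1.1 ⊓ f ∈ (φ.act a.1.2).source :=
  φ.source_lower _ inf_le_left ((φ.act a.1.2).map_target a.2)

/-- The element `φ_n⁻¹(φ_m⁻¹(e) ⊓ f)` lies in the domain of `φ_{mn}`, and is mapped where it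
should. -/
theorem mul_aux (a b : φ.Prod) :
    (φ.act b.1.2).symm ((φ.act a.1.2).symm a.1.1 ⊓ b.1.1) ∈ (φ.act b.1.2).source ∧
    (φ.act b.1.2).symm ((φ.act a.1.2).symm a.1.1 ⊓ b.1.1) ∈ (φ.act (a.1.2 * b.1.2)).source ∧
    φ.act b.1.2 ((φ.act b.1.2).symm ((φ.act a.1.2).symm a.1.1 ⊓ b.1.1)) =
      (φ.act a.1.2).symm a.1.1 ⊓ b.1.1 ∧
    φ.act (a.1.2 * b.1.2) ((φ.act b.1.2).symm ((φ.act a.1.2).symm a.1.1 ⊓ b.1.1)) =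
      φ.act a.1.2 ((φ.act a.1.2).symm a.1.1 ⊓ b.1.1) := by
  have ht : (φ.act a.1.2).symm a.1.1 ⊓ b.1.1 ∈ (φ.act b.1.2).target :=
    φ.target_lower _ inf_le_right b.2
  have hs := (φ.act b.1.2).map_target ht
  have hr := (φ.act b.1.2).right_inv ht
  have hm := symm_inf_mem a b.1.1
  refine ⟨hs, ?_, hr, ?_⟩
  · exact φ.mul_mem _ _ _ hs (by rw [hr]; exact hm)
  · rw [φ.mul_act _ _ _ hs (by rw [hr]; exact hm), hr]

/-- `(e, m)(f, n) = (φ_m(φ_m⁻¹(e) ⊓ f), mn)`. -/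
def mul (a b : φ.Prod) : φ.Prod :=
  ⟨(φ.act a.1.2 ((φ.act a.1.2).symm a.1.1 ⊓ b.1.1), a.1.2 * b.1.2), by
    obtain ⟨-, h, -, h'⟩ := mul_aux a b
    have := (φ.act (a.1.2 * b.1.2)).map_source h
    rwa [h'] at this⟩

/-- `(e, m)* = (φ_m⁻¹(e), 1)`. -/
def star (a : φ.Prod) : φ.Prod := ⟨((φ.act a.1.2).symm a.1.1, 1), φ.one_mem_target _⟩

/-- `(e, m)⁺ = (e, 1)`. -/
def plus (a : φ.Prod) : φ.Prod := ⟨(a.1.1, 1), φ.one_mem_target _⟩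

theorem mul_symm (a b : φ.Prod) :
    (φ.act (mul a b).1.2).symm (mul a b).1.1 =
      (φ.act b.1.2).symm ((φ.act a.1.2).symm a.1.1 ⊓ b.1.1) := by
  obtain ⟨-, h, -, h'⟩ := mul_aux a b
  have := (φ.act (a.1.2 * b.1.2)).left_inv h
  rwa [h'] at this

theorem act_inf_symm (a : φ.Prod) {e : E} (he : e ≤ a.1.1) (f : E) :
    φ.act a.1.2 ((φ.act a.1.2).symm e ⊓ f) =
      e ⊓ φ.act a.1.2 ((φ.act a.1.2).symm a.1.1 ⊓ f) := by
  have het : e ∈ (φ.act a.1.2).target := φ.target_lower _ he a.2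
  have hes := (φ.act a.1.2).map_target het
  have h1 : (φ.act a.1.2).symm e ⊓ f =
      (φ.act a.1.2).symm e ⊓ ((φ.act a.1.2).symm a.1.1 ⊓ f) := by
    rw [← inf_assoc, inf_eq_left.2 ((φ.symm_le_iff het a.2).2 he)]
  rw [h1, φ.map_inf hes (symm_inf_mem a f), (φ.act a.1.2).right_inv het]

variable [OrderTop E]

instance : BirestrictionMonoid φ.Prod where
  one := ⟨(⊤, 1), φ.one_mem_target _⟩
  mul := mul
  pstar := star
  pplus := plus
  one_mul a := by
    apply ext
    · change φ.act 1 ((φ.act 1).symm ⊤ ⊓ a.1.1) = a.1.1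
      rw [φ.one_symm, φ.one_act, top_inf_eq]
    · exact _root_.one_mul _
  mul_one a := by
    apply ext
    · change φ.act a.1.2 ((φ.act a.1.2).symm a.1.1 ⊓ ⊤) = a.1.1
      rw [inf_top_eq, (φ.act a.1.2).right_inv a.2]
    · exact _root_.mul_one _
  mul_assoc a b c := by
    apply ext
    · change φ.act (mul a b).1.2 ((φ.act (mul a b).1.2).symm (mul a b).1.1 ⊓ c.1.1) =
        φ.act a.1.2 ((φ.act a.1.2).symm a.1.1 ⊓ φ.act b.1.2 ((φ.act b.1.2).symm b.1.1 ⊓ c.1.1))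
      rw [mul_symm]
      obtain ⟨h1, h2, h3, h4⟩ := mul_aux a b
      have hs := φ.source_lower b.1.2 inf_le_left h1
        (b := (φ.act b.1.2).symm ((φ.act a.1.2).symm a.1.1 ⊓ b.1.1) ⊓ c.1.1)
      have hb : φ.act b.1.2 ((φ.act b.1.2).symm b.1.1 ⊓ c.1.1) ≤ b.1.1 := by
        rw [← (φ.act b.1.2).right_inv b.2, φ.le_iff _ _ _ _ ((φ.act b.1.2).map_target b.2),
          (φ.act b.1.2).right_inv b.2]
        · exact inf_le_left
        · rw [(φ.act b.1.2).right_inv b.2]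
          exact symm_inf_mem b _
      have hk : φ.act b.1.2 ((φ.act b.1.2).symm ((φ.act a.1.2).symm a.1.1 ⊓ b.1.1) ⊓ c.1.1) =
          (φ.act a.1.2).symm a.1.1 ⊓ φ.act b.1.2 ((φ.act b.1.2).symm b.1.1 ⊓ c.1.1) := by
        rw [act_inf_symm b inf_le_right, inf_assoc, inf_eq_right.2 hb]
      change φ.act (a.1.2 * b.1.2) _ = _
      rw [φ.mul_act _ _ _ hs (by rw [hk]; exact symm_inf_mem a _), hk]
    · exact _root_.mul_assoc _ _ _
  mul_pstar a := by
    apply ext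
    · change φ.act a.1.2 ((φ.act a.1.2).symm a.1.1 ⊓ (φ.act a.1.2).symm a.1.1) = a.1.1
      rw [inf_idem, (φ.act a.1.2).right_inv a.2]
    · exact _root_.mul_one _
  pstar_comm a b := by
    apply ext
    · change φ.act 1 ((φ.act 1).symm ((φ.act a.1.2).symm a.1.1) ⊓ (φ.act b.1.2).symm b.1.1) =
        φ.act 1 ((φ.act 1).symm ((φ.act b.1.2).symm b.1.1) ⊓ (φ.act a.1.2).symm a.1.1)
      simp only [φ.one_symm, φ.one_act, inf_comm]
    · rfl
  pstar_mul_pstar a b := by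
    apply ext
    · change (φ.act (mul a (star b)).1.2).symm (mul a (star b)).1.1 =
        φ.act 1 ((φ.act 1).symm ((φ.act a.1.2).symm a.1.1) ⊓ (φ.act b.1.2).symm b.1.1)
      rw [mul_symm]
      change (φ.act 1).symm ((φ.act a.1.2).symm a.1.1 ⊓ (φ.act b.1.2).symm b.1.1) = _
      simp only [φ.one_symm, φ.one_act]
    · exact (_root_.one_mul _).symm
  pstar_mul a b := by
    apply ext
    · change φ.act 1 ((φ.act 1).symm ((φ.act a.1.2).symm a.1.1) ⊓ b.1.1) =
        φ.act b.1.2 ((φ.act b.1.2).symm b.1.1 ⊓ (φ.act (mul a b).1.2).symm (mul a b).1.1)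
      have ht : (φ.act a.1.2).symm a.1.1 ⊓ b.1.1 ∈ (φ.act b.1.2).target :=
        φ.target_lower _ inf_le_right b.2
      rw [mul_symm, inf_eq_right.2 ((φ.symm_le_iff ht b.2).2 inf_le_right),
        (φ.act b.1.2).right_inv ht, φ.one_symm, φ.one_act]
    · change 1 * b.1.2 = b.1.2 * 1
      rw [_root_.one_mul, _root_.mul_one]
  pplus_mul a := by
    apply ext
    · change φ.act 1 ((φ.act 1).symm a.1.1 ⊓ a.1.1) = a.1.1
      rw [φ.one_symm, φ.one_act, inf_idem]
    · exact _root_.one_mul _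
  pplus_comm a b := by
    apply ext
    · change φ.act 1 ((φ.act 1).symm a.1.1 ⊓ b.1.1) = φ.act 1 ((φ.act 1).symm b.1.1 ⊓ a.1.1)
      simp only [φ.one_symm, φ.one_act, inf_comm]
    · rfl
  pplus_pplus_mul a b := by
    apply ext
    · rfl
    · exact (_root_.one_mul _).symm
  mul_pplus a b := by
    apply ext
    · change φ.act a.1.2 ((φ.act a.1.2).symm a.1.1 ⊓ b.1.1) =
        φ.act 1 ((φ.act 1).symm (φ.act a.1.2 ((φ.act a.1.2).symm a.1.1 ⊓ b.1.1)) ⊓ a.1.1)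
      rw [φ.one_symm, φ.one_act]
      refine (inf_eq_left.2 ?_).symm
      conv_rhs => rw [← (φ.act a.1.2).right_inv a.2]
      exact (φ.le_iff _ _ (symm_inf_mem a _) _ ((φ.act a.1.2).map_target a.2)).2 inf_le_left
    · change a.1.2 * 1 = 1 * a.1.2
      rw [_root_.one_mul, _root_.mul_one]
  pstar_pplus a := by
    apply ext
    · exact φ.one_symm _
    · rfl
  pplus_pstar a := rfl

end Prod

end PartialAction

open InverseMonoid in
/-- A map `t : M → I` to an inverse monoid with `t(1) = 1` and `t(m) t(n) ≤ t(mn)` (natural partial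
order) yields a partial action of `M` on `E(I)`: the map `φ_m` sends `e ≤ t(m)*` to
`(t(m) e)⁺ = t(m) e t(m)⁻¹ ≤ t(m)⁺`. -/
def PartialAction.ofMap {M I : Type*} [Monoid M] [InverseMonoid I] (t : M → I) (h1 : t 1 = 1)
    (hmul : ∀ m n, t m * t n = t m * t n * (t m * t n)⁻¹ * t (m * n)) :
    PartialAction M (Idem I) :=
  have key : ∀ m n (e : Idem I), e ≤ Idem.star (t n) → Idem.conj (t n) e ≤ Idem.star (t m) →
      e ≤ Idem.star (t (m * n)) ∧
        Idem.conj (t (m * n)) e = Idem.conj (t m) (Idem.conj (t n) e) := by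
    intro m n e he hne
    set p := t m * t n with hp
    set q := t (m * n)
    have hpq : p = p * p⁻¹ * q := hmul m n
    have hpi : p⁻¹ = q⁻¹ * (p * p⁻¹) := by
      conv_lhs => rw [hpq]
      rw [mul_inv_rev', mul_inv_rev', inv_inv]
    have hqp : q * (p⁻¹ * p) = p := by
      calc q * (p⁻¹ * p) = q * q⁻¹ * (p * p⁻¹ * p) := by
            conv_lhs => rw [hpi]
            simp only [mul_assoc]
        _ = q * q⁻¹ * (p * p⁻¹) * q := by
          rw [mul_inv_mul, mul_assoc (q * q⁻¹), ← hpq]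
        _ = p * p⁻¹ * (q * q⁻¹ * q) := by rw [inv_comm]; simp only [mul_assoc]
        _ = p := by rw [mul_inv_mul, ← hpq]
    have hep : e ≤ Idem.star p := by
      have h2 : Idem.conj (t n)⁻¹ (Idem.conj (t n) e) ≤
          Idem.conj (t n)⁻¹ (Idem.star (t m)) := Idem.conj_mono _ hne
      rw [Idem.conj_inv_conj he] at h2
      refine h2.trans (le_of_eq (Idem.ext ?_))
      change (t n)⁻¹ * ((t m)⁻¹ * t m) * (t n)⁻¹⁻¹ = p⁻¹ * p
      rw [hp, mul_inv_rev', inv_inv]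
      simp only [mul_assoc]
    have hpq' : Idem.star p ≤ Idem.star q := by
      change p⁻¹ * p * (q⁻¹ * q) = p⁻¹ * p
      have : p * (q⁻¹ * q) = p := by
        conv_lhs => rw [hpq]
        conv_rhs => rw [hpq]
        rw [mul_assoc, ← mul_assoc q, mul_inv_mul]
      rw [mul_assoc, this]
    refine ⟨hep.trans hpq', Idem.ext ?_⟩
    have e1 : e.1 * (p⁻¹ * p) = e.1 := hep
    have e2 : p⁻¹ * p * e.1 = e.1 := Idem.le_iff'.1 hep
    change q * e.1 * q⁻¹ = t m * (t n * e.1 * (t n)⁻¹) * (t m)⁻¹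
    calc q * e.1 * q⁻¹ = q * (p⁻¹ * p * e.1 * (p⁻¹ * p)) * q⁻¹ := by rw [e2, e1]
      _ = q * (p⁻¹ * p) * e.1 * (q * (p⁻¹ * p))⁻¹ := by
        rw [mul_inv_rev' q, inv_eq_of_idem (e := p⁻¹ * p) (Idem.star p).2]; simp only [mul_assoc]
      _ = t m * (t n * e.1 * (t n)⁻¹) * (t m)⁻¹ := by
        rw [hqp, hp, mul_inv_rev']; simp only [mul_assoc]
  { act := fun m =>
      { toFun := Idem.conj (t m)
        invFun := Idem.conj (t m)⁻¹
        source := {e | e ≤ Idem.star (t m)}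
        target := {e | e ≤ Idem.plus (t m)}
        map_source' := fun e _ => Idem.conj_le_plus _ e
        map_target' := fun e _ => by
          have := Idem.conj_le_plus (t m)⁻¹ e
          rwa [Idem.plus_inv] at this
        left_inv' := fun e he => Idem.conj_inv_conj he
        right_inv' := fun e he => by
          have := Idem.conj_inv_conj (a := (t m)⁻¹) (e := e) (by rw [Idem.star_inv]; exact he)
          rwa [inv_inv] at this }
    source_nonempty := fun m => ⟨Idem.star (t m), le_refl (Idem.star (t m))⟩
    source_lower := fun m _ _ h he => le_trans h he
    target_lower := fun m _ _ h he => le_trans h he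
    le_iff := fun m e he f hf => ⟨fun h => by
      have := Idem.conj_mono (t m)⁻¹ h
      change Idem.conj (t m)⁻¹ (Idem.conj (t m) e) ≤ Idem.conj (t m)⁻¹ (Idem.conj (t m) f) at this
      rwa [Idem.conj_inv_conj he, Idem.conj_inv_conj hf] at this, fun h => Idem.conj_mono _ h⟩
    source_one := by
      refine Set.eq_univ_of_forall fun e => ?_
      change e.1 * ((t 1)⁻¹ * t 1) = e.1
      rw [h1, mul_one, inv_eq_of_idem (one_mul 1), mul_one]
    one_act := fun e => Idem.ext (by
      change t 1 * e.1 * (t 1)⁻¹ = e.1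
      rw [h1, inv_eq_of_idem (one_mul 1), mul_one, one_mul])
    mul_mem := fun m n e he hne => (key m n e he hne).1
    mul_act := fun m n e he hne => (key m n e he hne).2 }

/-! ## The presented monoids over the extended generators -/

/-- The free semigroup `X⁺`, as the non-empty words in the free monoid `X*`. -/
structure PosWord (X : Type*) where
  val : FreeMonoid X
  ne_one : val ≠ 1

namespace PosWord

variable {X : Type*}

/-- A letter, as a word. -/
def of (x : X) : PosWord X := ⟨FreeMonoid.of x, FreeMonoid.of_ne_one x⟩

instance : Mul (PosWord X) where
  mul u v := ⟨u.1 * v.1, fun h => u.2 (List.append_eq_nil_iff.1 h).1⟩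

end PosWord

/-- The extended set of generators, the disjoint union of `X` and a copy `{ū : u ∈ X⁺}` of `X⁺`. -/
abbrev ExtGen (X : Type*) : Type _ := X ⊕ PosWord X

/-- The generator `x`, as a term. -/
def genT {X : Type*} (x : X) : BTerm (ExtGen X) := .var (Sum.inl x)

/-- The generator `ū`, as a term. -/
def barT {X : Type*} (u : PosWord X) : BTerm (ExtGen X) := .var (Sum.inr u)

/-- The relations `N_i`. In all cases `x̄ ≥ x` (that is, `x = x̄ x*`) for `x ∈ X`, and for
`u, v ∈ X⁺` with `w = uv`: `ū v̄ = ū⁺ w̄` in the cases `ls` and `s`, `ū v̄ = w̄ v̄*` in the cases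
`rs` and `s`, and `w̄ = ū v̄` in the case `p`. -/
inductive Nrel {X : Type*} (i : Strength) : BTerm (ExtGen X) → BTerm (ExtGen X) → Prop
  | bar_ge (x : X) : Nrel i (genT x) (.mul (barT (.of x)) (.star (genT x)))
  | left_strong (hi : i = .ls ∨ i = .s) (u v : PosWord X) :
      Nrel i (.mul (barT u) (barT v)) (.mul (.plus (barT u)) (barT (u * v)))
  | right_strong (hi : i = .rs ∨ i = .s) (u v : PosWord X) :
      Nrel i (.mul (barT u) (barT v)) (.mul (barT (u * v)) (.star (barT v)))
  | perfect (hi : i = .p) (u v : PosWord X) :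
      Nrel i (barT (u * v)) (.mul (barT u) (barT v))

/-- The birestriction monoid `𝓕_i = BRestr⟨X ∪ X̄⁺ | N_i⟩`. -/
abbrev PresF (i : Strength) (X : Type*) : Type _ := BRestr (ExtGen X) (Nrel i)

/-- The inverse monoid `𝓘_i = Inv⟨X ∪ X̄⁺ | ψ(N_i)⟩`, the universal inverse monoid of `𝓕_i`. -/
abbrev InvI (i : Strength) (X : Type*) : Type _ := UnivInv (ExtGen X) (Nrel i)

open Classical in
/-- The element `ū` of `𝓘_i` for `u ∈ X*`, where `ū = 1` if `u = 1`. -/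
noncomputable def bar (i : Strength) {X : Type*} (u : FreeMonoid X) : InvI i X :=
  if h : u = 1 then 1 else InvPres.of (Sum.inr ⟨u, h⟩)

theorem bar_one (i : Strength) {X : Type*} : bar i (1 : FreeMonoid X) = 1 := dif_pos rfl

open InverseMonoid in
theorem bar_mul (i : Strength) {X : Type*} (u v : FreeMonoid X) :
    bar i u * bar i v = bar i u * bar i v * (bar i u * bar i v)⁻¹ * bar i (u * v) := by
  by_cases hu : u = 1
  · rw [hu, bar_one, one_mul, one_mul, mul_inv_mul]
  by_cases hv : v = 1
  · rw [hv, bar_one, mul_one, mul_one, mul_inv_mul]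
  have huv : u * v ≠ 1 := (⟨u, hu⟩ * ⟨v, hv⟩ : PosWord X).2
  have rel : ∀ s t : BTerm (ExtGen X), Nrel i s t →
      (InvPres.mk s.psi : InvI i X) = InvPres.mk t.psi := fun s t h =>
    InvPres.sound (ConGen.Rel.of _ _ (.rel ⟨s, t, h, rfl, rfl⟩))
  have ha : bar i u = InvPres.of (Sum.inr ⟨u, hu⟩) := dif_neg hu
  have hb : bar i v = InvPres.of (Sum.inr ⟨v, hv⟩) := dif_neg hv
  have hc : bar i (u * v) = InvPres.of (Sum.inr ⟨u * v, huv⟩) := dif_neg huv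
  have L : i = .ls ∨ i = .s → bar i u * bar i v = bar i u * (bar i u)⁻¹ * bar i (u * v) := by
    intro hi
    rw [ha, hb, hc]
    exact rel _ _ (.left_strong hi ⟨u, hu⟩ ⟨v, hv⟩)
  have R : i = .rs ∨ i = .s → bar i u * bar i v = bar i (u * v) * ((bar i v)⁻¹ * bar i v) := by
    intro hi
    rw [ha, hb, hc]
    exact rel _ _ (.right_strong hi ⟨u, hu⟩ ⟨v, hv⟩)
  have P : i = .p → bar i (u * v) = bar i u * bar i v := by
    intro hi
    rw [ha, hb, hc]
    exact rel _ _ (.perfect hi ⟨u, hu⟩ ⟨v, hv⟩)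
  have L' : ∀ a b c : InvI i X, b = a * a⁻¹ * c → b = b * b⁻¹ * c := by
    intro a b c h
    have hE : a * a⁻¹ * (a * a⁻¹) = a * a⁻¹ := (Idem.plus a).2
    calc b = a * a⁻¹ * (c * c⁻¹ * c) := by rw [mul_inv_mul, ← h]
      _ = c * c⁻¹ * (a * a⁻¹) * c := by rw [← mul_assoc, inv_comm]
      _ = c * c⁻¹ * (a * a⁻¹ * (a * a⁻¹)) * c := by rw [hE]
      _ = a * a⁻¹ * (c * c⁻¹) * (a * a⁻¹) * c := by
        rw [← mul_assoc, inv_comm]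
      _ = b * b⁻¹ * c := by
        rw [h, mul_inv_rev', mul_inv_rev', inv_inv]; simp only [mul_assoc]
  cases i with
  | ls => exact L' _ _ _ (L (Or.inl rfl))
  | s => exact L' _ _ _ (L (Or.inr rfl))
  | p => rw [P rfl, mul_inv_mul]
  | rs =>
    have h := R (Or.inl rfl)
    generalize bar Strength.rs u * bar Strength.rs v = b at *
    generalize bar Strength.rs (u * v) = c at *
    generalize bar Strength.rs v = a at *
    refine L' (c * (a⁻¹ * a)) b c ?_
    have hE : a⁻¹ * a * (a⁻¹ * a) = a⁻¹ * a := (Idem.star a).2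
    have hi : (a⁻¹ * a)⁻¹ = a⁻¹ * a := inv_eq_of_idem hE
    have hc : a⁻¹ * a * (c⁻¹ * c) = c⁻¹ * c * (a⁻¹ * a) :=
      idem_comm hE (Idem.star c).2
    calc b = c * c⁻¹ * c * (a⁻¹ * a) := by rw [mul_inv_mul, h]
      _ = c * (c⁻¹ * c * (a⁻¹ * a)) := by simp only [mul_assoc]
      _ = c * (a⁻¹ * a * (a⁻¹ * a) * (c⁻¹ * c)) := by rw [hE, hc]
      _ = c * (a⁻¹ * a) * (c * (a⁻¹ * a))⁻¹ * c := by
        rw [mul_inv_rev', hi]; simp only [mul_assoc]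

/-- The partial action of `X*` on `E(𝓘_i)`: `φ_u(e) = (ū e)⁺` for `e ≤ ū*`. -/
noncomputable def partialAct (i : Strength) (X : Type*) :
    PartialAction (FreeMonoid X) (Idem (InvI i X)) :=
  PartialAction.ofMap (bar i) (bar_one i) (bar_mul i)

/-- The partial action product `E(𝓘_i) ⋊ X*`. -/
abbrev EProd (i : Strength) (X : Type*) : Type _ := (partialAct i X).Prod

end FBirestr

open FBirestr FBirestr.BirestrictionMonoid

/-!
The monoid `X*`, with trivial unary operations, is an image of `𝓕_i` under a map `word` with
`x ↦ x`, `ū ↦ u`. The relations `N_i` give `ū v̄ ≤ w̄` for `w = uv`, so that by induction every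
element `s` of `𝓕_i` lies below `ū`, where `u` is the word of `s` (`le_barF_word`). Hence two
elements are `σ`-related exactly when they have the same word, and `ū` is the maximum of its
`σ`-class (`isSigmaMax_barF`). The relations `N_i` then say precisely that `𝓕_i` has the required
strength, and they hold for the elements `x` and `u^𝔪` of `FFBR_i(X)` (`nrel_eval_ffbr`); the two
universal properties yield mutually inverse morphisms (`exists_iso_ffbr_presF`).

For the second description, every `s` in `𝓕_i` satisfies `s = s⁺ ū` for its word `u`, so it is
determined by the projection `s⁺` and by `u`. It remains to identify the projections of `𝓕_i` with
the idempotents of `𝓘_i`, and this works for every birestriction monoid `S` given by generators and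
relations. The Munn representation sends `s` to the partial bijection `e ↦ (s e)⁺`, `e ≤ s*`, of the
projections of `S`. It is a morphism to an inverse monoid, so it factors through the universal
inverse monoid of `S`, and it is injective on projections; therefore the canonical map to the
universal inverse monoid is injective on projections as well (`toInv_injOn_proj`). Conversely, each
idempotent is `w w⁻¹` for a word `w` over the generators and their inverses, and conjugation by a
generator or by its inverse is computed in `S` by `p ↦ (y p)⁺` or `p ↦ (p y)*`
(`exists_proj_toInv_eq`). So `s ↦ (s⁺, u)` is an isomorphism of birestriction monoids from `𝓕_i` to
`E(𝓘_i) ⋊ X*` (`isBirestrictionHom_toEProd`, `bijective_toEProd`), along which the maximum elements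
are transported.
-/

namespace FBirestr

/-! ### Calculus in birestriction monoids -/

section Calculus

variable {S : Type*} [BirestrictionMonoid S]

theorem isProj_pstar (s : S) : IsProj (pstar s) := ⟨s, rfl⟩

theorem pstar_mul_eq_of_isProj {e : S} (he : IsProj e) (x : S) : pstar (x * e) = pstar x * e := by
  obtain ⟨s, rfl⟩ := he
  exact pstar_mul_pstar x s

theorem pplus_mul_eq_of_isProj {e : S} (he : IsProj e) (x : S) : pplus (e * x) = e * pplus x := by
  have h := pplus_pplus_mul e x
  rwa [pplus_proj he] at h

theorem proj_mul_comm {e : S} (he : IsProj e) (x : S) : e * x = x * pstar (e * x) := by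
  have h := pstar_mul e x
  rwa [pstar_proj he] at h

theorem mul_proj_comm {e : S} (he : IsProj e) (x : S) : x * e = pplus (x * e) * x := by
  have h := mul_pplus x e
  rwa [pplus_proj he] at h

theorem pplus_mul_pplus_mul (x y : S) : pplus x * pplus (x * y) = pplus (x * y) := by
  rw [← pplus_pplus_mul, ← mul_assoc, pplus_mul]

theorem pstar_mul_mul_pstar (x y : S) : pstar (x * y) * pstar y = pstar (x * y) := by
  rw [← pstar_mul_pstar, mul_assoc, mul_pstar]

theorem pplus_mul_pplus (x y : S) : pplus (x * pplus y) = pplus (x * y) := by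
  rw [mul_pplus, pplus_pplus_mul, pplus_comm, pplus_mul_pplus_mul]

theorem NatLE.refl (s : S) : NatLE s s := ⟨1, isProj_one, (one_mul s).symm⟩

theorem NatLE.trans {s t u : S} (h : NatLE s t) (h' : NatLE t u) : NatLE s u := by
  obtain ⟨e, he, rfl⟩ := h
  obtain ⟨f, hf, rfl⟩ := h'
  exact ⟨e * f, proj_mul he hf, (mul_assoc e f u).symm⟩

theorem natLE_one {e : S} (he : IsProj e) : NatLE e 1 := ⟨e, he, (mul_one e).symm⟩

theorem natLE_mul_proj {e : S} (he : IsProj e) (s : S) : NatLE (s * e) s :=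
  ⟨_, isProj_pplus _, mul_proj_comm he s⟩

theorem NatLE.mul {s t s' t' : S} (h : NatLE s t) (h' : NatLE s' t') :
    NatLE (s * s') (t * t') := by
  obtain ⟨e, he, rfl⟩ := h
  rw [h'.eq_mul_pstar, mul_assoc e, ← mul_assoc t]
  exact NatLE.trans ⟨e, he, rfl⟩ (natLE_mul_proj (isProj_pstar s') _)

theorem NatLE.eq_pplus_mul {s t : S} (h : NatLE s t) : s = pplus s * t := by
  obtain ⟨e, he, rfl⟩ := h
  rw [pplus_mul_eq_of_isProj he, mul_assoc, pplus_mul]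

theorem NatLE.sigma {s t : S} (h : NatLE s t) : sigma S s t := by
  refine sigma_iff.2 ⟨pstar s, isProj_pstar s, ?_⟩
  rw [mul_pstar, ← h.eq_mul_pstar]

end Calculus

namespace IsBirestrictionHom

variable {S T U : Type*} [BirestrictionMonoid S] [BirestrictionMonoid T] [BirestrictionMonoid U]
  {f : S → T} {g : T → U}

theorem id : IsBirestrictionHom (fun s : S => s) :=
  ⟨rfl, fun _ _ => rfl, fun _ => rfl, fun _ => rfl⟩

theorem comp (hg : IsBirestrictionHom g) (hf : IsBirestrictionHom f) :
    IsBirestrictionHom fun s => g (f s) where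
  map_one := by rw [hf.map_one, hg.map_one]
  map_mul x y := by rw [hf.map_mul, hg.map_mul]
  map_pstar x := by rw [hf.map_pstar, hg.map_pstar]
  map_pplus x := by rw [hf.map_pplus, hg.map_pplus]

theorem isProj (hf : IsBirestrictionHom f) {e : S} (he : IsProj e) : IsProj (f e) := by
  obtain ⟨s, rfl⟩ := he
  exact ⟨f s, (hf.map_pstar s).symm⟩

theorem natLE (hf : IsBirestrictionHom f) {s t : S} (h : NatLE s t) : NatLE (f s) (f t) := by
  obtain ⟨e, he, rfl⟩ := h
  exact ⟨f e, hf.isProj he, hf.map_mul e t⟩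

theorem sigma (hf : IsBirestrictionHom f) {s t : S} (h : sigma S s t) :
    FBirestr.sigma T (f s) (f t) := by
  obtain ⟨e, he, h⟩ := sigma_iff.1 h
  exact sigma_iff.2 ⟨f e, hf.isProj he, by rw [← hf.map_mul, h, hf.map_mul]⟩

theorem symm (hf : IsBirestrictionHom f) {k : T → S} (hl : ∀ s, k (f s) = s)
    (hr : ∀ t, f (k t) = t) : IsBirestrictionHom k where
  map_one := by rw [← hf.map_one, hl]
  map_mul x y := by rw [← hl (k x * k y), hf.map_mul, hr, hr]
  map_pstar x := by rw [← hl (pstar (k x)), hf.map_pstar, hr]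
  map_pplus x := by rw [← hl (pplus (k x)), hf.map_pplus, hr]

/-- An isomorphism of birestriction monoids carries maximum elements of `σ`-classes to maximum
elements of `σ`-classes. -/
theorem isSigmaMax_of_bijective (hf : IsBirestrictionHom f) (hb : Function.Bijective f) {s m : S}
    (h : IsSigmaMax s m) : IsSigmaMax (f s) (f m) := by
  obtain ⟨k, hl, hr⟩ := Function.bijective_iff_has_inverse.1 hb
  refine ⟨hf.sigma h.1, fun t ht => ?_⟩
  have h1 := (hf.symm hl hr).sigma ht
  rw [hl] at h1
  have h2 := hf.natLE (h.2 _ h1)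
  rwa [hr] at h2

end IsBirestrictionHom

/-! ### The Munn representation -/

section Munn

open InverseMonoid

/-- The symmetric inverse monoid: partial bijections of `α`, composed as functions, so that `f * g`
is `g` followed by `f`. -/
instance symmetricInverseMonoid (α : Type*) : InverseMonoid (α ≃. α) where
  one := PEquiv.refl α
  mul f g := g.trans f
  inv f := f.symm
  mul_assoc f g h := (PEquiv.trans_assoc h g f).symm
  one_mul f := PEquiv.trans_refl f
  mul_one f := PEquiv.refl_trans f
  inv_inv _ := rfl
  mul_inv_rev' _ _ := rfl
  mul_inv_mul f := by
    change f.trans (f.symm.trans f) = f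
    refine PEquiv.ext fun a => Option.ext fun b => ?_
    simp only [← Option.mem_def, PEquiv.mem_trans, PEquiv.mem_iff_mem]
    exact ⟨fun ⟨c, hc, d, hd, hb⟩ => by rwa [f.inj hc hd], fun h => ⟨b, h, a, h, h⟩⟩
  inv_comm f g := by
    change (g.symm.trans g).trans (f.symm.trans f) = (f.symm.trans f).trans (g.symm.trans g)
    simp only [PEquiv.symm_trans_self]
    refine PEquiv.ext fun a => Option.ext fun b => ?_
    simp only [← Option.mem_def, PEquiv.mem_trans, PEquiv.mem_ofSet_iff]
    constructor
    · rintro ⟨_, ⟨rfl, hg⟩, rfl, hf⟩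
      exact ⟨_, ⟨rfl, hf⟩, rfl, hg⟩
    · rintro ⟨_, ⟨rfl, hf⟩, rfl, hg⟩
      exact ⟨_, ⟨rfl, hg⟩, rfl, hf⟩

variable {S : Type*} [BirestrictionMonoid S]

variable (S) in
/-- The projections of a birestriction monoid. -/
abbrev Proj : Type _ := {e : S // IsProj e}

/-- The elements `e ≤ s*` and `f ≤ s⁺` with `s e = f s`: the graph of the partial bijection of
projections induced by `s`. -/
def MunnRel (s e f : S) : Prop := pstar s * e = e ∧ pplus s * f = f ∧ s * e = f * s

theorem munnRel_iff_left {s e f : S} (he : IsProj e) (hf : IsProj f) :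
    MunnRel s e f ↔ pstar s * e = e ∧ pplus (s * e) = f := by
  constructor
  · rintro ⟨h1, h2, h3⟩
    refine ⟨h1, ?_⟩
    rw [h3, pplus_mul_eq_of_isProj hf, proj_comm hf (isProj_pplus s), h2]
  · rintro ⟨h1, rfl⟩
    exact ⟨h1, pplus_mul_pplus_mul s e, mul_proj_comm he s⟩

theorem munnRel_iff_right {s e f : S} (he : IsProj e) (hf : IsProj f) :
    MunnRel s e f ↔ pplus s * f = f ∧ pstar (f * s) = e := by
  constructor
  · rintro ⟨h1, h2, h3⟩
    refine ⟨h2, ?_⟩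
    rw [← h3, pstar_mul_eq_of_isProj he, h1]
  · rintro ⟨h1, rfl⟩
    refine ⟨?_, h1, (proj_mul_comm hf s).symm⟩
    rw [pstar_comm, pstar_mul_mul_pstar]

open Classical in
/-- The Munn representation of a birestriction monoid by partial bijections of its projections:
`s` sends `e ≤ s*` to `(s e)⁺`. -/
noncomputable def munn (s : S) : Proj S ≃. Proj S where
  toFun e := if pstar s * e.1 = e.1 then some ⟨pplus (s * e.1), isProj_pplus _⟩ else none
  invFun f := if pplus s * f.1 = f.1 then some ⟨pstar (f.1 * s), isProj_pstar _⟩ else none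
  inv e f := by
    have hl := munnRel_iff_left (s := s) e.2 f.2
    have hr := munnRel_iff_right (s := s) e.2 f.2
    simpa only [Option.mem_def, Option.ite_none_right_eq_some, Option.some.injEq, Subtype.ext_iff]
      using hr.symm.trans hl

open Classical in
theorem mem_munn {s : S} {e f : Proj S} : f ∈ munn s e ↔ MunnRel s e.1 f.1 := by
  rw [munnRel_iff_left e.2 f.2]
  change f ∈ (if pstar s * e.1 = e.1 then some _ else none : Option (Proj S)) ↔ _
  simp only [Option.mem_def, Option.ite_none_right_eq_some, Option.some.injEq, Subtype.ext_iff]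

theorem munn_ext {p : Proj S ≃. Proj S} {s : S}
    (h : ∀ e f, f ∈ p e ↔ MunnRel s e.1 f.1) : p = munn s :=
  PEquiv.ext fun e => Option.ext fun f => (h e f).trans mem_munn.symm

theorem munnRel_proj {p e f : S} (hp : IsProj p) (he : IsProj e) (hf : IsProj f) :
    MunnRel p e f ↔ e = f ∧ p * e = e := by
  rw [munnRel_iff_left he hf, pstar_proj hp, pplus_proj (proj_mul hp he)]
  exact ⟨fun ⟨h, h'⟩ => ⟨h ▸ h', h⟩, fun ⟨h, h'⟩ => ⟨h', h ▸ h'⟩⟩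

theorem munn_one : munn (1 : S) = 1 := by
  symm
  refine munn_ext fun e f => ?_
  rw [munnRel_proj isProj_one e.2 f.2]
  change f ∈ PEquiv.refl _ e ↔ _
  simp [Subtype.ext_iff]

theorem munn_mul (s t : S) : munn (s * t) = munn s * munn t := by
  symm
  refine munn_ext fun e g => ?_
  change g ∈ (munn t).trans (munn s) e ↔ _
  simp only [PEquiv.mem_trans, mem_munn]
  constructor
  · rintro ⟨⟨f, hf⟩, ⟨h1, h2, h3⟩, h4, h5, h6⟩
    have key : s * t * e.1 = g.1 * (s * t) := by rw [mul_assoc, h3, ← mul_assoc, h6, mul_assoc]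
    refine ⟨?_, ?_, key⟩
    · have h := pstar_mul s t
      have h7 : t * (pstar (s * t) * e.1) = t * e.1 := by
        rw [← mul_assoc, ← h, mul_assoc, h3, ← mul_assoc, h4]
      have h8 := congrArg pstar h7
      rwa [pstar_mul_eq_of_isProj (proj_mul (isProj_pstar _) e.2), pstar_mul_eq_of_isProj e.2,
        h1, ← mul_assoc, pstar_comm, mul_assoc, h1] at h8
    · have h := mul_pplus s t
      have h7 : g.1 * pplus (s * t) * s = g.1 * s := by
        rw [mul_assoc, ← h, ← mul_assoc, ← h6, mul_assoc, proj_comm hf (isProj_pplus t), h2]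
      have h8 := congrArg pplus h7
      rw [pplus_mul_eq_of_isProj (proj_mul g.2 (isProj_pplus _)), pplus_mul_eq_of_isProj g.2,
        proj_comm g.2 (isProj_pplus s), h5, mul_assoc, pplus_comm, ← mul_assoc,
        proj_comm g.2 (isProj_pplus s), h5] at h8
      rw [proj_comm (isProj_pplus _) g.2, h8]
  · rintro ⟨h1, h2, h3⟩
    -- the intermediate projection is `(t e)⁺`
    have h4 : pstar t * e.1 = e.1 := by
      rw [← h1, ← mul_assoc, pstar_comm, pstar_mul_mul_pstar]
    refine ⟨⟨pplus (t * e.1), isProj_pplus _⟩, (munnRel_iff_left e.2 (isProj_pplus _)).2 ⟨h4, rfl⟩,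
      ?_⟩
    have h5 : pplus s * g.1 = g.1 := by
      rw [← h2, ← mul_assoc, pplus_mul_pplus_mul]
    refine (munnRel_iff_left (isProj_pplus _) g.2).2 ⟨?_, ?_⟩
    · rw [← pplus_mul_eq_of_isProj (isProj_pstar s), ← mul_assoc, pstar_mul, mul_assoc, h1]
    · rw [pplus_mul_pplus, ← mul_assoc, h3, pplus_mul_eq_of_isProj g.2,
        proj_comm g.2 (isProj_pplus _), h2]

theorem munn_pstar (s : S) : munn (pstar s) = (munn s)⁻¹ * munn s := by
  symm
  refine munn_ext fun e g => ?_
  rw [munnRel_proj (isProj_pstar s) e.2 g.2]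
  change g ∈ (munn s).trans (munn s).symm e ↔ _
  simp only [PEquiv.mem_trans, PEquiv.mem_iff_mem]
  constructor
  · rintro ⟨f, h, h'⟩
    exact ⟨congrArg Subtype.val ((munn s).inj h h'), (mem_munn.1 h).1⟩
  · rintro ⟨h, h'⟩
    obtain rfl : e = g := Subtype.ext h
    have hm : (⟨_, isProj_pplus (s * e.1)⟩ : Proj S) ∈ munn s e :=
      mem_munn.2 ((munnRel_iff_left e.2 (isProj_pplus _)).2 ⟨h', rfl⟩)
    exact ⟨_, hm, hm⟩

theorem munn_pplus (s : S) : munn (pplus s) = munn s * (munn s)⁻¹ := by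
  symm
  refine munn_ext fun e g => ?_
  rw [munnRel_proj (isProj_pplus s) e.2 g.2]
  change g ∈ (munn s).symm.trans (munn s) e ↔ _
  simp only [PEquiv.mem_trans, PEquiv.mem_iff_mem]
  constructor
  · rintro ⟨f, h, h'⟩
    exact ⟨congrArg Subtype.val (Option.some_injective _ (h.symm.trans h')), (mem_munn.1 h).2.1⟩
  · rintro ⟨h, h'⟩
    obtain rfl : e = g := Subtype.ext h
    have hm : e ∈ munn s ⟨_, isProj_pstar (e.1 * s)⟩ :=
      mem_munn.2 ((munnRel_iff_right (isProj_pstar _) e.2).2 ⟨h', rfl⟩)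
    exact ⟨_, hm, hm⟩

/-- The Munn representation separates projections. -/
theorem munn_injOn_proj {e f : S} (he : IsProj e) (hf : IsProj f) (h : munn e = munn f) :
    e = f := by
  have key : ∀ {e f : S}, IsProj e → IsProj f → munn e = munn f → f * e = e := by
    intro e f he hf h
    have h1 : (⟨e, he⟩ : Proj S) ∈ munn e ⟨e, he⟩ :=
      mem_munn.2 ((munnRel_proj he he he).2 ⟨rfl, proj_idem he⟩)
    rw [h] at h1
    exact ((munnRel_proj hf he he).1 (mem_munn.1 h1)).2
  rw [← key he hf h, proj_comm hf he, key hf he h.symm]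

end Munn

/-! ### Universal properties of presentations -/

/-- The value of a birestriction term under an assignment. -/
def BTerm.eval {Y T : Type*} [BirestrictionMonoid T] (f : Y → T) : BTerm Y → T
  | .var y => f y
  | .one => 1
  | .mul s t => eval f s * eval f t
  | .star t => pstar (eval f t)
  | .plus t => pplus (eval f t)

namespace BRestr

variable {Y : Type*} {R : BTerm Y → BTerm Y → Prop} {T : Type*} [BirestrictionMonoid T]

theorem eval_eq_of_bRel {f : Y → T} (hR : ∀ a b, R a b → a.eval f = b.eval f) {a b : BTerm Y}
    (h : BRel R a b) : a.eval f = b.eval f := by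
  induction h with
  | rel h => exact hR _ _ h
  | refl a => rfl
  | symm _ ih => exact ih.symm
  | trans _ _ ih ih' => exact ih.trans ih'
  | mul_congr _ _ ih ih' => exact congrArg₂ (· * ·) ih ih'
  | star_congr _ ih => exact congrArg pstar ih
  | plus_congr _ ih => exact congrArg pplus ih
  | mul_assoc x y z => exact _root_.mul_assoc _ _ _
  | one_mul x => exact _root_.one_mul _
  | mul_one x => exact _root_.mul_one _
  | mul_star x => exact mul_pstar _
  | star_comm x y => exact pstar_comm _ _
  | star_mul_star x y => exact pstar_mul_pstar _ _
  | star_mul x y => exact pstar_mul _ _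
  | plus_mul x => exact pplus_mul _
  | plus_comm x y => exact pplus_comm _ _
  | plus_plus_mul x y => exact pplus_pplus_mul _ _
  | mul_plus x y => exact mul_pplus _ _
  | star_plus x => exact pstar_pplus _
  | plus_star x => exact pplus_pstar _

/-- The morphism out of `BRestr⟨Y | R⟩` that extends an assignment satisfying the relations. -/
def lift (f : Y → T) (hR : ∀ a b, R a b → a.eval f = b.eval f) : BRestr Y R → T :=
  Quotient.lift (s := BTerm.setoid R) (BTerm.eval f) fun _ _ h => eval_eq_of_bRel hR h

theorem isBirestrictionHom_lift (f : Y → T) (hR : ∀ a b, R a b → a.eval f = b.eval f) :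
    IsBirestrictionHom (lift f hR) where
  map_one := rfl
  map_mul := ind fun _ => ind fun _ => rfl
  map_pstar := ind fun _ => rfl
  map_pplus := ind fun _ => rfl

/-- Induction on the elements of a birestriction monoid given by generators and relations. -/
theorem induction {p : BRestr Y R → Prop} (of : ∀ y, p (of y)) (one : p 1)
    (mul : ∀ s t, p s → p t → p (s * t)) (star : ∀ s, p s → p (pstar s))
    (plus : ∀ s, p s → p (pplus s)) (s : BRestr Y R) : p s := by
  induction s using ind with | _ t =>
  induction t with
  | var y => exact of y
  | one => exact one
  | mul s t ih ih' => exact mul _ _ ih ih'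
  | star t ih => exact star _ ih
  | plus t ih => exact plus _ ih

theorem hom_ext {f g : BRestr Y R → T} (hf : IsBirestrictionHom f) (hg : IsBirestrictionHom g)
    (h : ∀ y, f (of y) = g (of y)) (s : BRestr Y R) : f s = g s := by
  induction s using induction with
  | of y => exact h y
  | one => rw [hf.map_one, hg.map_one]
  | mul s t ih ih' => rw [hf.map_mul, hg.map_mul, ih, ih']
  | star s ih => rw [hf.map_pstar, hg.map_pstar, ih]
  | plus s ih => rw [hf.map_pplus, hg.map_pplus, ih]

end BRestr

open InverseMonoid

section InverseMonoid

variable {I : Type*} [InverseMonoid I]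

theorem one_inv' : (1 : I)⁻¹ = 1 := inv_eq_of_idem (one_mul 1)

theorem mul_proj_mul_inv (a : I) {e : I} (he : e * e = e) :
    a * e * (a * e)⁻¹ = a * e * a⁻¹ := by
  rw [mul_inv_rev', inv_eq_of_idem he, ← mul_assoc, mul_assoc a, he]

theorem inv_mul_proj_mul (a : I) {e : I} (he : e * e = e) :
    (e * a)⁻¹ * (e * a) = a⁻¹ * e * a := by
  rw [mul_inv_rev', inv_eq_of_idem he, mul_assoc, ← mul_assoc e, he, ← mul_assoc]

theorem inv_mul_idem (a : I) : a⁻¹ * a * (a⁻¹ * a) = a⁻¹ * a := (Idem.star a).2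

theorem mul_inv_idem (a : I) : a * a⁻¹ * (a * a⁻¹) = a * a⁻¹ := (Idem.plus a).2

theorem inv_mul_comm_mul_inv (a b : I) : a⁻¹ * a * (b * b⁻¹) = b * b⁻¹ * (a⁻¹ * a) :=
  idem_comm (inv_mul_idem a) (mul_inv_idem b)

variable (I) in
/-- An inverse monoid is a birestriction monoid with `a* = a⁻¹ a` and `a⁺ = a a⁻¹`. -/
abbrev InverseMonoid.toBirestrictionMonoid : BirestrictionMonoid I where
  pstar a := a⁻¹ * a
  pplus a := a * a⁻¹
  mul_pstar a := by rw [← mul_assoc, mul_inv_mul]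
  pstar_comm a b := idem_comm (inv_mul_idem a) (inv_mul_idem b)
  pstar_mul_pstar a b := by
    have hb := inv_mul_idem b
    rw [mul_inv_rev', inv_eq_of_idem hb, ← mul_assoc, mul_assoc (b⁻¹ * b),
      idem_comm hb (inv_mul_idem a), mul_assoc, hb]
  pstar_mul a b := by
    calc a⁻¹ * a * b = a⁻¹ * a * (b * b⁻¹) * b := by rw [mul_assoc (a⁻¹ * a) _ b, mul_inv_mul]
      _ = b * ((a * b)⁻¹ * (a * b)) := by
        rw [inv_mul_comm_mul_inv, mul_inv_rev']; simp only [mul_assoc]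
  pplus_mul a := mul_inv_mul a
  pplus_comm a b := inv_comm a b
  pplus_pplus_mul a b := by
    rw [mul_inv_rev', inv_eq_of_idem (mul_inv_idem a), ← mul_assoc, mul_assoc _ b, mul_assoc,
      inv_comm b a, ← mul_assoc, mul_inv_idem]
  mul_pplus a b := by
    calc a * (b * b⁻¹) = a * a⁻¹ * a * (b * b⁻¹) := by rw [mul_inv_mul]
      _ = a * (a⁻¹ * a * (b * b⁻¹)) := by simp only [mul_assoc]
      _ = a * b * (a * b)⁻¹ * a := by
        rw [inv_mul_comm_mul_inv, mul_inv_rev']; simp only [mul_assoc]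
  pstar_pplus a := by rw [inv_eq_of_idem (mul_inv_idem a), mul_inv_idem]
  pplus_pstar a := by rw [inv_eq_of_idem (inv_mul_idem a), inv_mul_idem]

end InverseMonoid

namespace InvWord

variable {Y I : Type*} [InverseMonoid I]

/-- The value of a word over `Y ∪ Y⁻¹` in an inverse monoid. -/
def eval (f : Y → I) : InvWord Y →* I :=
  FreeMonoid.lift fun p => cond p.2 (f p.1) (f p.1)⁻¹

theorem eval_inv (f : Y → I) (w : InvWord Y) : eval f w.inv = (eval f w)⁻¹ := by
  induction w using FreeMonoid.inductionOn' with
  | one => exact (map_one _).trans (one_inv'.symm.trans (congrArg _ (map_one (eval f)).symm))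
  | of_mul p w ih =>
    rw [inv_mul, map_mul, map_mul, ih, mul_inv_rev']
    congr 1
    obtain ⟨y, b⟩ := p
    cases b with
    | true => exact FreeMonoid.lift_eval_of _ _
    | false =>
      change eval f (FreeMonoid.of (y, true)) = _
      refine (FreeMonoid.lift_eval_of _ _).trans ?_
      rw [eval, FreeMonoid.lift_eval_of]
      exact (_root_.inv_inv (f y)).symm

theorem eval_eq_of_conGen {R : InvWord Y → InvWord Y → Prop} {f : Y → I}
    (hR : ∀ u v, R u v → eval f u = eval f v) {u v : InvWord Y} (h : conGen (InvRel R) u v) :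
    eval f u = eval f v := by
  have hle : conGen (InvRel R) ≤ Con.ker (eval f) := by
    refine Con.conGen_le.2 fun u v h => ?_
    change eval f u = eval f v
    cases h with
    | regular => rw [map_mul, map_mul, eval_inv, mul_inv_mul]
    | comm a b => simp only [map_mul, eval_inv, inv_comm]
    | rel h => exact hR _ _ h
    | rel_inv h => rw [eval_inv, eval_inv, hR _ _ h]
  exact hle h

end InvWord

/-! ### Projections and the universal inverse monoid -/

section UniversalInverse

variable {Y : Type*} {R : BTerm Y → BTerm Y → Prop}

variable (R) in
/-- The canonical map from a birestriction monoid given by generators and relations to its universal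
inverse monoid. -/
def toInv : BRestr Y R → UnivInv Y R :=
  Quotient.lift (s := BTerm.setoid R) (fun t => InvPres.mk t.psi) fun a b h => by
    let _ := InverseMonoid.toBirestrictionMonoid (UnivInv Y R)
    have key : ∀ t : BTerm Y, (InvPres.mk t.psi : UnivInv Y R) = t.eval InvPres.of := by
      intro t
      induction t with
      | var y => rfl
      | one => rfl
      | mul s t ih ih' => exact congrArg₂ (· * ·) ih ih'
      | star t ih => exact congrArg pstar ih
      | plus t ih => exact congrArg pplus ih
    change (InvPres.mk a.psi : UnivInv Y R) = InvPres.mk b.psi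
    rw [key, key]
    refine BRestr.eval_eq_of_bRel (fun a b hab => ?_) h
    rw [← key, ← key]
    exact InvPres.sound (ConGen.Rel.of _ _ (.rel ⟨a, b, hab, rfl, rfl⟩))

theorem toInv_one : toInv R 1 = 1 := rfl

theorem toInv_mul (s t : BRestr Y R) : toInv R (s * t) = toInv R s * toInv R t := by
  induction s using BRestr.ind
  induction t using BRestr.ind
  rfl

theorem toInv_pstar (s : BRestr Y R) : toInv R (pstar s) = (toInv R s)⁻¹ * toInv R s := by
  induction s using BRestr.ind
  rfl

theorem toInv_pplus (s : BRestr Y R) : toInv R (pplus s) = toInv R s * (toInv R s)⁻¹ := by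
  induction s using BRestr.ind
  rfl

theorem toInv_proj_idem {p : BRestr Y R} (hp : IsProj p) :
    toInv R p * toInv R p = toInv R p := by
  rw [← toInv_mul, proj_idem hp]

/-- The Munn representation of `BRestr⟨Y | R⟩` at a term is the value of the word `ψ(t)` in the
symmetric inverse monoid. -/
theorem munn_mk (t : BTerm Y) : munn (BRestr.mk t : BRestr Y R) =
    InvWord.eval (fun y => munn (BRestr.of y : BRestr Y R)) t.psi := by
  induction t with
  | var y => exact (FreeMonoid.lift_eval_of _ _).symm
  | one => exact munn_one.trans (map_one _).symm
  | mul s t ih ih' =>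
    refine (munn_mul (BRestr.mk s : BRestr Y R) (BRestr.mk t)).trans ?_
    rw [ih, ih', ← map_mul]
    rfl
  | star t ih =>
    refine (munn_pstar (BRestr.mk t : BRestr Y R)).trans ?_
    rw [ih, ← InvWord.eval_inv, ← map_mul]
    rfl
  | plus t ih =>
    refine (munn_pplus (BRestr.mk t : BRestr Y R)).trans ?_
    rw [ih, ← InvWord.eval_inv, ← map_mul]
    rfl

/-- The canonical map to the universal inverse monoid separates projections: the Munn
representation takes values in an inverse monoid, so it factors through the universal one. -/
theorem toInv_injOn_proj {e f : BRestr Y R} (he : IsProj e) (hf : IsProj f)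
    (h : toInv R e = toInv R f) : e = f := by
  refine munn_injOn_proj he hf ?_
  clear he hf
  induction e using BRestr.ind with | _ s =>
  induction f using BRestr.ind with | _ t =>
  rw [munn_mk, munn_mk]
  refine InvWord.eval_eq_of_conGen ?_ ((Con.eq _).1 h)
  rintro _ _ ⟨a, b, hab, rfl, rfl⟩
  rw [← munn_mk, ← munn_mk, BRestr.sound (.rel hab)]

/-- Every idempotent of the universal inverse monoid is the image of a projection. -/
theorem exists_proj_toInv_eq (e : Idem (UnivInv Y R)) :
    ∃ p : BRestr Y R, IsProj p ∧ toInv R p = e.1 := by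
  have key : ∀ w : InvWord Y, ∃ p : BRestr Y R, IsProj p ∧
      toInv R p = InvPres.mk w * (InvPres.mk w)⁻¹ := by
    intro w
    induction w using FreeMonoid.inductionOn' with
    | one => exact ⟨1, isProj_one, ((one_mul _).trans one_inv').symm⟩
    | of_mul a w ih =>
      obtain ⟨p, hp, h⟩ := ih
      obtain ⟨y, b⟩ := a
      have hi := toInv_proj_idem hp
      have hc : ∀ a x : UnivInv Y R, a * x * (a * x)⁻¹ = a * (x * x⁻¹) * a⁻¹ := by
        intro a x
        rw [mul_inv_rev']
        simp only [mul_assoc]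
      cases b with
      | true =>
        refine ⟨pplus (BRestr.of y * p), isProj_pplus _, ?_⟩
        rw [toInv_pplus, toInv_mul, mul_proj_mul_inv _ hi, h]
        exact (hc (InvPres.of y) (InvPres.mk w)).symm
      | false =>
        refine ⟨pstar (p * BRestr.of y), isProj_pstar _, ?_⟩
        rw [toInv_pstar, toInv_mul, inv_mul_proj_mul _ hi, h]
        have h1 := (hc (InvPres.of y)⁻¹ (InvPres.mk w)).symm
        rw [inv_inv] at h1
        exact h1
  obtain ⟨a, he⟩ := e
  induction a using InvPres.ind with | _ w =>
  obtain ⟨p, hp, h⟩ := key w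
  refine ⟨p, hp, h.trans ?_⟩
  rw [inv_eq_of_idem he, he]

end UniversalInverse

/-! ### Maximum elements in `𝓕_i` -/

section PresF

variable {i : Strength} {X : Type*}

open Classical in
/-- The element `ū` of `𝓕_i` for `u ∈ X*`, where `ū = 1` if `u = 1`. -/
noncomputable def barF (i : Strength) {X : Type*} (u : FreeMonoid X) : PresF i X :=
  if h : u = 1 then 1 else BRestr.of (Sum.inr ⟨u, h⟩)

theorem barF_one : barF i (1 : FreeMonoid X) = 1 := dif_pos rfl

theorem barF_val (u : PosWord X) : barF i u.1 = BRestr.of (Sum.inr u) := dif_neg u.2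

theorem eq_one_or_posWord (u : FreeMonoid X) : u = 1 ∨ ∃ w : PosWord X, w.1 = u :=
  or_iff_not_imp_left.2 fun h => ⟨⟨u, h⟩, rfl⟩

theorem PosWord.val_mul (u v : PosWord X) : (u * v).1 = u.1 * v.1 := rfl

theorem of_le_barF (x : X) :
    NatLE (BRestr.of (Sum.inl x) : PresF i X) (barF i (FreeMonoid.of x)) := by
  have h : barF i (FreeMonoid.of x) = BRestr.of (Sum.inr (PosWord.of x)) := barF_val (PosWord.of x)
  rw [h]
  exact natLE_of_eq_mul_pstar (BRestr.sound (.rel (.bar_ge x)))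

theorem barF_mul_left (hi : i = .ls ∨ i = .s) (u v : FreeMonoid X) :
    barF i u * barF i v = pplus (barF i u) * barF i (u * v) := by
  rcases eq_one_or_posWord u with rfl | ⟨u, rfl⟩
  · rw [barF_one, pplus_proj isProj_one, one_mul, one_mul, one_mul]
  rcases eq_one_or_posWord v with rfl | ⟨v, rfl⟩
  · rw [barF_one, mul_one, mul_one, pplus_mul]
  rw [← PosWord.val_mul, barF_val, barF_val, barF_val]
  exact BRestr.sound (.rel (.left_strong hi u v))

theorem barF_mul_right (hi : i = .rs ∨ i = .s) (u v : FreeMonoid X) :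
    barF i u * barF i v = barF i (u * v) * pstar (barF i v) := by
  rcases eq_one_or_posWord v with rfl | ⟨v, rfl⟩
  · rw [barF_one, pstar_one, mul_one, mul_one, mul_one]
  rcases eq_one_or_posWord u with rfl | ⟨u, rfl⟩
  · rw [barF_one, one_mul, one_mul, mul_pstar]
  rw [← PosWord.val_mul, barF_val, barF_val, barF_val]
  exact BRestr.sound (.rel (.right_strong hi u v))

theorem barF_mul_perfect (hi : i = .p) (u v : FreeMonoid X) :
    barF i u * barF i v = barF i (u * v) := by
  rcases eq_one_or_posWord v with rfl | ⟨v, rfl⟩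
  · rw [barF_one, mul_one, mul_one]
  rcases eq_one_or_posWord u with rfl | ⟨u, rfl⟩
  · rw [barF_one, one_mul, one_mul]
  rw [← PosWord.val_mul, barF_val, barF_val, barF_val]
  exact (BRestr.sound (.rel (.perfect hi u v))).symm

theorem barF_mul_le (u v : FreeMonoid X) : NatLE (barF i u * barF i v) (barF i (u * v)) := by
  have hl (hi : i = .ls ∨ i = .s) : NatLE (barF i u * barF i v) (barF i (u * v)) :=
    ⟨_, isProj_pplus _, barF_mul_left hi u v⟩
  cases i with
  | ls => exact hl (Or.inl rfl)
  | s => exact hl (Or.inr rfl)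
  | rs =>
    rw [barF_mul_right (Or.inl rfl)]
    exact natLE_mul_proj (isProj_pstar _) _
  | p =>
    rw [barF_mul_perfect rfl]
    exact NatLE.refl _

/-- A monoid is a birestriction monoid whose only projection is `1`. -/
abbrev trivialBirestrictionMonoid (M : Type*) [Monoid M] : BirestrictionMonoid M where
  pstar _ := 1
  pplus _ := 1
  mul_pstar := mul_one
  pstar_comm _ _ := rfl
  pstar_mul_pstar _ _ := (mul_one 1).symm
  pstar_mul _ z := (one_mul z).trans (mul_one z).symm
  pplus_mul := one_mul
  pplus_comm _ _ := rfl
  pplus_pplus_mul _ _ := (mul_one 1).symm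
  mul_pplus y _ := (mul_one y).trans (one_mul y).symm
  pstar_pplus _ := rfl
  pplus_pstar _ := rfl

/-- The canonical morphism `𝓕_i → X*` that sends `x` to `x`, `ū` to `u` and projections to `1`; its
kernel turns out to be `σ`. -/
def word : PresF i X → FreeMonoid X :=
  letI := trivialBirestrictionMonoid (FreeMonoid X)
  BRestr.lift (Sum.elim FreeMonoid.of PosWord.val) fun a b h => by
    cases h with
    | bar_ge x => exact (mul_one (FreeMonoid.of x)).symm
    | left_strong hi u v => exact (one_mul (u * v).1).symm
    | right_strong hi u v => exact (mul_one (u * v).1).symm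
    | perfect hi u v => rfl

theorem word_one : word (1 : PresF i X) = 1 := rfl

theorem word_mul (s t : PresF i X) : word (s * t) = word s * word t := by
  induction s using BRestr.ind
  induction t using BRestr.ind
  rfl

theorem word_pstar (s : PresF i X) : word (pstar s) = 1 := by
  induction s using BRestr.ind
  rfl

theorem word_pplus (s : PresF i X) : word (pplus s) = 1 := by
  induction s using BRestr.ind
  rfl

theorem word_proj {e : PresF i X} (he : IsProj e) : word e = 1 := by
  obtain ⟨s, rfl⟩ := he
  exact word_pstar s

theorem word_barF (u : FreeMonoid X) : word (barF i u) = u := by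
  rcases eq_one_or_posWord u with rfl | ⟨u, rfl⟩
  · rw [barF_one, word_one]
  · rw [barF_val]
    rfl

/-- Every element of `𝓕_i` lies below `ū`, where `u` is its word. -/
theorem le_barF_word (s : PresF i X) : NatLE s (barF i (word s)) := by
  induction s using BRestr.induction with
  | of y =>
    cases y with
    | inl x => exact of_le_barF x
    | inr u =>
      have h : barF i (word (BRestr.of (Sum.inr u) : PresF i X)) = BRestr.of (Sum.inr u) :=
        barF_val u
      rw [h]
      exact NatLE.refl _
  | one =>
    rw [word_one, barF_one]
    exact NatLE.refl _
  | mul s t ih ih' =>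
    rw [word_mul]
    exact (ih.mul ih').trans (barF_mul_le _ _)
  | star s ih =>
    rw [word_pstar, barF_one]
    exact natLE_one (isProj_pstar s)
  | plus s ih =>
    rw [word_pplus, barF_one]
    exact natLE_one (isProj_pplus s)

theorem word_eq_of_sigma {s t : PresF i X} (h : sigma (PresF i X) s t) : word s = word t := by
  obtain ⟨e, he, h⟩ := sigma_iff.1 h
  have h' := congrArg word h
  rwa [word_mul, word_mul, word_proj he, mul_one, mul_one] at h'

theorem isSigmaMax_barF (s : PresF i X) : IsSigmaMax s (barF i (word s)) :=
  ⟨(le_barF_word s).sigma, fun t h => by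
    rw [word_eq_of_sigma h]
    exact le_barF_word t⟩

instance isFBirestriction_presF : IsFBirestriction (PresF i X) := ⟨fun s => ⟨_, isSigmaMax_barF s⟩⟩

theorem mx_presF (s : PresF i X) : mx s = barF i (word s) := mx_eq (isSigmaMax_barF s)

theorem hasStrength_presF : HasStrength i (PresF i X) := by
  have hp := isPremorphism_tau (PresF i X)
  have hl (hi : i = .ls ∨ i = .s) : IsLeftStrong (tau (PresF i X)) := by
    intro m n
    induction m using Con.induction_on with | _ a =>
    induction n using Con.induction_on with | _ b =>
    change mx a * mx b = pplus (mx a) * mx (a * b)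
    rw [mx_presF, mx_presF, mx_presF, word_mul, barF_mul_left hi]
  have hr (hi : i = .rs ∨ i = .s) : IsRightStrong (tau (PresF i X)) := by
    intro m n
    induction m using Con.induction_on with | _ a =>
    induction n using Con.induction_on with | _ b =>
    change mx a * mx b = mx (a * b) * pstar (mx b)
    rw [mx_presF, mx_presF, mx_presF, word_mul, barF_mul_right hi]
  cases i with
  | ls => exact ⟨hp, hl (Or.inl rfl)⟩
  | rs => exact ⟨hp, hr (Or.inl rfl)⟩
  | s => exact ⟨hp, hl (Or.inr rfl), hr (Or.inr rfl)⟩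
  | p =>
    refine ⟨hp.map_one, fun m n => ?_⟩
    induction m using Con.induction_on with | _ a =>
    induction n using Con.induction_on with | _ b =>
    change mx (a * b) = mx a * mx b
    rw [mx_presF, mx_presF, mx_presF, word_mul, barF_mul_perfect rfl]

/-! ### The isomorphism of `FFBR_i(X)` with `𝓕_i` -/

/-- The elements `x` and `u^𝔪` of `FFBR_i(X)` satisfy the relations `N_i`. -/
theorem nrel_eval_ffbr {a b : BTerm (ExtGen X)} (h : Nrel i a b) :
    a.eval (Sum.elim FFBR.of fun u => mx (FreeMonoid.lift FFBR.of u.1) : ExtGen X → FFBR i X) =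
      b.eval (Sum.elim FFBR.of fun u => mx (FreeMonoid.lift FFBR.of u.1)) := by
  cases h with
  | bar_ge x =>
    change FFBR.of x = mx (FreeMonoid.lift FFBR.of (FreeMonoid.of x)) * pstar (FFBR.of x)
    rw [FreeMonoid.lift_eval_of, mx_mul_pstar]
  | left_strong hi u v =>
    change mx (FreeMonoid.lift FFBR.of u.1) * mx (FreeMonoid.lift FFBR.of v.1) =
      pplus (mx (FreeMonoid.lift FFBR.of u.1)) * mx (FreeMonoid.lift FFBR.of (u.1 * v.1))
    rw [map_mul]
    generalize FreeMonoid.lift (FFBR.of (i := i)) u.1 = a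
    generalize FreeMonoid.lift (FFBR.of (i := i)) v.1 = b
    induction a using FFBR.ind with | _ a =>
    induction b using FFBR.ind with | _ b =>
    change _ = _ * mx (FFBR.mk (.mul a b))
    simp only [FFBR.mx_mk]
    exact FFBR.sound (.left_strong hi a b)
  | right_strong hi u v =>
    change mx (FreeMonoid.lift FFBR.of u.1) * mx (FreeMonoid.lift FFBR.of v.1) =
      mx (FreeMonoid.lift FFBR.of (u.1 * v.1)) * pstar (mx (FreeMonoid.lift FFBR.of v.1))
    rw [map_mul]
    generalize FreeMonoid.lift (FFBR.of (i := i)) u.1 = a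
    generalize FreeMonoid.lift (FFBR.of (i := i)) v.1 = b
    induction a using FFBR.ind with | _ a =>
    induction b using FFBR.ind with | _ b =>
    change _ = mx (FFBR.mk (.mul a b)) * _
    simp only [FFBR.mx_mk]
    exact FFBR.sound (.right_strong hi a b)
  | perfect hi u v =>
    change mx (FreeMonoid.lift FFBR.of (u.1 * v.1)) =
      mx (FreeMonoid.lift FFBR.of u.1) * mx (FreeMonoid.lift FFBR.of v.1)
    rw [map_mul]
    generalize FreeMonoid.lift (FFBR.of (i := i)) u.1 = a
    generalize FreeMonoid.lift (FFBR.of (i := i)) v.1 = b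
    induction a using FFBR.ind with | _ a =>
    induction b using FFBR.ind with | _ b =>
    change mx (FFBR.mk (.mul a b)) = _
    simp only [FFBR.mx_mk]
    exact (FFBR.sound (.perfect hi a b)).symm

theorem mx_mx {S : Type*} [BirestrictionMonoid S] [IsFBirestriction S] (s : S) :
    mx (mx s) = mx s :=
  (mx_congr (mx_spec s).1).symm

theorem mx_one' {S : Type*} [BirestrictionMonoid S] [IsFBirestriction S] : mx (1 : S) = 1 :=
  (isPremorphism_tau S).map_one

theorem IsFBirestrictionHom.comp {S T U : Type*} [BirestrictionMonoid S] [IsFBirestriction S]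
    [BirestrictionMonoid T] [IsFBirestriction T] [BirestrictionMonoid U] [IsFBirestriction U]
    {f : S → T} {g : T → U} (hg : IsFBirestrictionHom g) (hf : IsFBirestrictionHom f) :
    IsFBirestrictionHom fun s => g (f s) :=
  ⟨hg.toIsBirestrictionHom.comp hf.toIsBirestrictionHom, fun s => by rw [hf.map_mx, hg.map_mx]⟩

theorem IsBirestrictionHom.map_lift {S T : Type*} [BirestrictionMonoid S] [BirestrictionMonoid T]
    {f : S → T} (hf : IsBirestrictionHom f) (k : X → S) (u : FreeMonoid X) :
    f (FreeMonoid.lift k u) = FreeMonoid.lift (fun x => f (k x)) u := by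
  induction u using FreeMonoid.inductionOn' with
  | one => rw [_root_.map_one, _root_.map_one, hf.map_one]
  | of_mul x u ih => rw [_root_.map_mul, _root_.map_mul, hf.map_mul, ih, FreeMonoid.lift_eval_of,
      FreeMonoid.lift_eval_of]

theorem word_lift (u : FreeMonoid X) :
    word (FreeMonoid.lift (fun x => (BRestr.of (Sum.inl x) : PresF i X)) u) = u := by
  induction u using FreeMonoid.inductionOn' with
  | one => rfl
  | of_mul x u ih =>
    rw [map_mul, word_mul, ih, FreeMonoid.lift_eval_of]
    rfl

/-- The morphism `𝓕_i → FFBR_i(X)` with `x ↦ x` and `ū ↦ u^𝔪` also preserves the maximum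
elements. -/
theorem exists_hom_presF_ffbr : ∃ k : PresF i X → FFBR i X, IsFBirestrictionHom k ∧
    (∀ x, k (BRestr.of (Sum.inl x)) = FFBR.of x) ∧
    ∀ u : PosWord X, k (BRestr.of (Sum.inr u)) = mx (FreeMonoid.lift FFBR.of u.1) := by
  have hk := BRestr.isBirestrictionHom_lift _ fun a b => nrel_eval_ffbr (i := i) (X := X)
  refine ⟨_, ⟨hk, fun t => ?_⟩, fun _ => rfl, fun _ => rfl⟩
  rw [mx_congr (hk.sigma (mx_spec t).1), mx_presF]
  rcases eq_one_or_posWord (word t) with h | ⟨u, h⟩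
  · rw [h, barF_one, hk.map_one, mx_one']
  · rw [← h, barF_val]
    exact (mx_mx _).symm

theorem exists_iso_ffbr_presF : ∃ f : FFBR i X → PresF i X, Function.Bijective f ∧
    IsFBirestrictionHom f ∧ (∀ x : X, f (FFBR.of x) = BRestr.of (Sum.inl x)) ∧
    (∀ u : PosWord X, f (mx (FreeMonoid.lift FFBR.of u.1)) = BRestr.of (Sum.inr u)) := by
  obtain ⟨f, ⟨hf, hfx⟩, -⟩ := FFBR.existsUnique_lift (hasStrength_presF (i := i) (X := X))
    fun x => BRestr.of (Sum.inl x)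
  obtain ⟨k, hk, hkx, hku⟩ := exists_hom_presF_ffbr (i := i) (X := X)
  have hfu : ∀ u : PosWord X, f (mx (FreeMonoid.lift FFBR.of u.1)) = BRestr.of (Sum.inr u) := by
    intro u
    rw [hf.map_mx, hf.toIsBirestrictionHom.map_lift, mx_presF]
    simp only [hfx]
    rw [word_lift, barF_val]
  refine ⟨f, Function.bijective_iff_has_inverse.2 ⟨k, fun s => ?_, fun t => ?_⟩, hf, hfx, hfu⟩
  · obtain ⟨_, -, huniq⟩ := FFBR.existsUnique_lift (FFBR.hasStrength (i := i) (X := X)) FFBR.of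
    have h1 := huniq (fun s => k (f s)) ⟨hk.comp hf, fun x => (congrArg k (hfx x)).trans (hkx x)⟩
    have h2 := huniq (fun s => s) ⟨⟨.id, fun _ => rfl⟩, fun _ => rfl⟩
    exact congrFun (h1.trans h2.symm) s
  · refine BRestr.hom_ext (hf.toIsBirestrictionHom.comp hk.toIsBirestrictionHom) .id ?_ t
    rintro (x | u)
    · rw [hkx, hfx]
    · rw [hku, hfu]

end PresF

/-! ### The isomorphism of `𝓕_i` with `E(𝓘_i) ⋊ X*` -/

section EProd

open InverseMonoid

variable {i : Strength} {X : Type*}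

/-- If `a = a⁺ c`, that is, `a ≤ c`, then `(a b)⁺ = a⁺ (c b⁺)⁺`: the first component of a product
in the partial action product. -/
theorem Idem.plus_mul_of_le {I : Type*} [InverseMonoid I] {a c : I} (h : a = a * a⁻¹ * c) (b : I) :
    Idem.plus (a * b) = Idem.plus a ⊓ Idem.plus (c * (b * b⁻¹)) := by
  apply Idem.ext
  change a * b * (a * b)⁻¹ = a * a⁻¹ * (c * (b * b⁻¹) * (c * (b * b⁻¹))⁻¹)
  have hi := (Idem.plus (c * (b * b⁻¹))).2
  change c * (b * b⁻¹) * (c * (b * b⁻¹))⁻¹ * _ = c * (b * b⁻¹) * (c * (b * b⁻¹))⁻¹ at hi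
  have hc := idem_comm (mul_inv_idem a) hi
  rw [mul_proj_mul_inv c (mul_inv_idem b)] at hc ⊢
  calc a * b * (a * b)⁻¹ = a * (b * b⁻¹) * a⁻¹ := by rw [mul_inv_rev']; simp only [mul_assoc]
    _ = a * a⁻¹ * c * (b * b⁻¹) * (a * a⁻¹ * c)⁻¹ := by rw [← h]
    _ = a * a⁻¹ * (c * (b * b⁻¹) * c⁻¹ * (a * a⁻¹)) := by
      rw [mul_inv_rev' _ c, inv_eq_of_idem (mul_inv_idem a)]; simp only [mul_assoc]
    _ = a * a⁻¹ * (c * (b * b⁻¹) * c⁻¹) := by rw [← hc, ← mul_assoc, mul_inv_idem]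

theorem eProd_mul (a b : EProd i X) : (a * b).1 =
    (a.1.1 ⊓ Idem.plus (bar i a.1.2 * b.1.1.1), a.1.2 * b.1.2) := by
  refine Prod.ext (Idem.ext ?_) rfl
  have ha : bar i a.1.2 * (bar i a.1.2)⁻¹ * a.1.1.1 = a.1.1.1 := Idem.le_iff'.1 a.2
  change bar i a.1.2 * ((bar i a.1.2)⁻¹ * a.1.1.1 * (bar i a.1.2)⁻¹⁻¹ * b.1.1.1) *
    (bar i a.1.2)⁻¹ = a.1.1.1 * (bar i a.1.2 * b.1.1.1 * (bar i a.1.2 * b.1.1.1)⁻¹)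
  rw [mul_proj_mul_inv _ b.1.1.2, inv_inv]
  conv_rhs => rw [← ha]
  simp only [mul_assoc]

theorem eProd_pstar (a : EProd i X) :
    (pstar a).1 = (Idem.star (a.1.1.1 * bar i a.1.2), 1) := by
  refine Prod.ext (Idem.ext ?_) rfl
  change (bar i a.1.2)⁻¹ * a.1.1.1 * (bar i a.1.2)⁻¹⁻¹ =
    (a.1.1.1 * bar i a.1.2)⁻¹ * (a.1.1.1 * bar i a.1.2)
  rw [inv_mul_proj_mul _ a.1.1.2, inv_inv]

theorem exists_eProd_iff (e : Idem (InvI i X)) (u : FreeMonoid X) :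
    (∃ a : EProd i X, a.1 = (e, u)) ↔ e ≤ Idem.plus (bar i u) := by
  constructor
  · rintro ⟨a, ha⟩
    have h : a.1.1 ≤ Idem.plus (bar i a.1.2) := a.2
    rwa [ha] at h
  · exact fun h => ⟨⟨(e, u), h⟩, rfl⟩

theorem toInv_barF (u : FreeMonoid X) : toInv (Nrel i) (barF i u) = bar i u := by
  rcases eq_one_or_posWord u with rfl | ⟨u, rfl⟩
  · rw [barF_one, bar_one, toInv_one]
  · rw [barF_val]
    have h : bar i u.1 = InvPres.of (Sum.inr u) := dif_neg u.2
    exact h.symm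

theorem toInv_eq_mul_bar (s : PresF i X) :
    toInv (Nrel i) s = toInv (Nrel i) s * (toInv (Nrel i) s)⁻¹ * bar i (word s) := by
  have h := congrArg (toInv (Nrel i)) (le_barF_word s).eq_pplus_mul
  rwa [toInv_mul, toInv_pplus, toInv_barF] at h

/-- The map `𝓕_i → E(𝓘_i) ⋊ X*` that sends `s` to `(s⁺, u)`, where `u` is the word of `s`. -/
def toEProd (s : PresF i X) : EProd i X where
  val := (Idem.plus (toInv (Nrel i) s), word s)
  mem := by
    change Idem.plus _ ≤ Idem.plus (bar i (word s))
    have h : Idem.plus (toInv (Nrel i) s * 1) = _ := Idem.plus_mul_of_le (toInv_eq_mul_bar s) 1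
    rw [mul_one, one_inv', mul_one, mul_one] at h
    rw [h]
    exact inf_le_right

theorem eProd_ext {a b : EProd i X} (h : a.1 = b.1) : a = b :=
  PartialAction.Prod.ext (congrArg Prod.fst h) (congrArg Prod.snd h)

theorem isBirestrictionHom_toEProd : IsBirestrictionHom (toEProd : PresF i X → EProd i X) where
  map_one := eProd_ext (Prod.ext (Idem.ext ((one_mul _).trans one_inv')) rfl)
  map_mul s t := by
    refine eProd_ext ?_
    rw [eProd_mul]
    refine Prod.ext ?_ (word_mul s t)
    change Idem.plus (toInv (Nrel i) (s * t)) = _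
    rw [toInv_mul]
    exact Idem.plus_mul_of_le (toInv_eq_mul_bar s) _
  map_pstar s := by
    refine eProd_ext ?_
    rw [eProd_pstar]
    refine Prod.ext (Idem.ext ?_) (word_pstar s)
    change toInv (Nrel i) (pstar s) * (toInv (Nrel i) (pstar s))⁻¹ =
      (toInv (Nrel i) s * (toInv (Nrel i) s)⁻¹ * bar i (word s))⁻¹ *
        (toInv (Nrel i) s * (toInv (Nrel i) s)⁻¹ * bar i (word s))
    rw [← toInv_eq_mul_bar, toInv_pstar, inv_eq_of_idem (inv_mul_idem _), inv_mul_idem]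
  map_pplus s := by
    refine eProd_ext (Prod.ext (Idem.ext ?_) (word_pplus s))
    change toInv (Nrel i) (pplus s) * (toInv (Nrel i) (pplus s))⁻¹ = _
    rw [toInv_pplus, inv_eq_of_idem (mul_inv_idem _), mul_inv_idem]
    rfl

/-- An element of `𝓕_i` is determined by its word and by `s⁺`, as `s = s⁺ ū`, and the projections of
`𝓕_i` correspond to the idempotents of `𝓘_i`. -/
theorem bijective_toEProd : Function.Bijective (toEProd : PresF i X → EProd i X) := by
  constructor
  · intro s t h
    have hw : word s = word t := congrArg (fun a => a.1.2) h
    have hp : toInv (Nrel i) s * (toInv (Nrel i) s)⁻¹ =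
        toInv (Nrel i) t * (toInv (Nrel i) t)⁻¹ := congrArg (fun a => a.1.1.1) h
    rw [← toInv_pplus, ← toInv_pplus] at hp
    rw [(le_barF_word s).eq_pplus_mul, (le_barF_word t).eq_pplus_mul, hw,
      toInv_injOn_proj (isProj_pplus s) (isProj_pplus t) hp]
  · intro a
    obtain ⟨p, hp, h⟩ := exists_proj_toInv_eq a.1.1
    have ha : a.1.1.1 * (bar i a.1.2 * (bar i a.1.2)⁻¹) = a.1.1.1 := a.2
    refine ⟨p * barF i a.1.2, eProd_ext (Prod.ext (Idem.ext ?_) ?_)⟩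
    · change toInv (Nrel i) (p * barF i a.1.2) * (toInv (Nrel i) (p * barF i a.1.2))⁻¹ = _
      rw [toInv_mul, h, toInv_barF, mul_inv_rev', inv_eq_of_idem a.1.1.2, ← mul_assoc,
        mul_assoc a.1.1.1, ha, a.1.1.2]
    · change word (p * barF i a.1.2) = _
      rw [word_mul, word_proj hp, one_mul, word_barF]

theorem isSigmaMax_eProd (a : EProd i X) : IsSigmaMax a (toEProd (barF i a.1.2)) := by
  obtain ⟨s, rfl⟩ := bijective_toEProd.2 a
  exact isBirestrictionHom_toEProd.isSigmaMax_of_bijective bijective_toEProd (isSigmaMax_barF s)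

instance isFBirestriction_eProd : IsFBirestriction (EProd i X) :=
  ⟨fun a => ⟨_, isSigmaMax_eProd a⟩⟩

theorem eProd_mx (a : EProd i X) : (mx a).1 = (Idem.plus (bar i a.1.2), a.1.2) := by
  rw [mx_eq (isSigmaMax_eProd a)]
  change (Idem.plus (toInv (Nrel i) (barF i a.1.2)), word (barF i a.1.2)) = _
  rw [toInv_barF, word_barF]

theorem isFBirestrictionHom_toEProd :
    IsFBirestrictionHom (toEProd : PresF i X → EProd i X) :=
  ⟨isBirestrictionHom_toEProd, fun s => by
    rw [mx_eq (isSigmaMax_eProd (toEProd s)), mx_presF]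
    rfl⟩

end EProd

end FBirestr

theorem mainTheorem4 {X : Type*} [Nonempty X] (i : Strength) :
    -- `𝓕_i` and `E(𝓘_i) ⋊ X*` are `F`-birestriction monoids
    ∃ (_ : IsFBirestriction (PresF i X)) (_ : IsFBirestriction (EProd i X)),
      -- the canonical isomorphism `FFBR_i(X) ≅ 𝓕_i`
      (∃ f : FFBR i X → PresF i X, Function.Bijective f ∧ IsFBirestrictionHom f ∧
        (∀ x : X, f (FFBR.of x) = BRestr.of (Sum.inl x)) ∧
        (∀ u : PosWord X, f (mx (FreeMonoid.lift FFBR.of u.1)) = BRestr.of (Sum.inr u))) ∧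
      -- the canonical isomorphism `FFBR_i(X) ≅ E(𝓘_i) ⋊ X*`
      (∃ g : FFBR i X → EProd i X, Function.Bijective g ∧ IsFBirestrictionHom g ∧
        (∀ x : X, (g (FFBR.of x)).1 =
          (Idem.plus (InvPres.of (Sum.inl x) : InvI i X), FreeMonoid.of x))) ∧
      -- the carrier, the operations and the maximum elements of `E(𝓘_i) ⋊ X*`
      (∀ (e : Idem (InvI i X)) (u : FreeMonoid X),
        (∃ a : EProd i X, a.1 = (e, u)) ↔ e ≤ Idem.plus (bar i u)) ∧
      (1 : EProd i X).1 = (⊤, 1) ∧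
      (∀ a b : EProd i X, (a * b).1 =
        (a.1.1 ⊓ Idem.plus (bar i a.1.2 * b.1.1.1), a.1.2 * b.1.2)) ∧
      (∀ a : EProd i X, (pstar a).1 = (Idem.star (a.1.1.1 * bar i a.1.2), 1)) ∧
      (∀ a : EProd i X, (pplus a).1 = (a.1.1, 1)) ∧
      (∀ a : EProd i X, (mx a).1 = (Idem.plus (bar i a.1.2), a.1.2)) := by
  obtain ⟨f, hb, hf, hfx, hfu⟩ := exists_iso_ffbr_presF (i := i) (X := X)
  refine ⟨isFBirestriction_presF, isFBirestriction_eProd, ⟨f, hb, hf, hfx, hfu⟩,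
    ⟨fun s => toEProd (f s), bijective_toEProd.comp hb, isFBirestrictionHom_toEProd.comp hf,
      fun x => ?_⟩, exists_eProd_iff, rfl, eProd_mul, eProd_pstar, fun _ => rfl, eProd_mx⟩
  change (toEProd (f (FFBR.of x))).1 = _
  rw [hfx]
  rfl
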